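/- **Problem.** An instance of \textsc{MaxTaskWithinTotalBudget} consists of $n$ robots $r_1,\dots,r_n$, $m$ tasks $t_1,\dots,t_m$, requirements $q_1,\dots,q_m\in\mathbb{N}$, non-negative rational costs $c_{ij}$ ($i\in[n]$, $j\in[m]$) and a budget $W\in\mathbb{N}$. An allocation assigns at most one task to every robot; its total cost is the sum of $c_{ij}$ over all pairs such that $r_i$ is assigned to $t_j$; a task $t_j$ is handled if at least $q_j$ robots are assigned to it. The aim is to find an allocation of total cost at most $W$ that handles as many tasks as possible; the maximum number is denoted by $\mathrm{opt}(I)$. The costs are symmetric if $c_{ij}=c_{kj}=:c_j$ for all $i,k\in[n]$ and $j\in[m]$. An instance $I$ with symmetric costs is given by the numbers $n,m,W,q_1,\dots,q_m$ and the numerators and denominators of $c_1,\dots,c_m$; its length $|I|$ is the number of bits of these numbers in binary (with a separator after each number). Since $n$ is written in binary, an allocation is output as a list $s_1,\dots,s_m,k_1,\dots,k_m$, which means that, with the robots numbered $0,\dots,n-1$, task $t_j$ gets the robots with numbers $i$, $s_j\le i<s_j+k_j$. **Theorem.** With symmetric costs, \textsc{MaxTaskWithinTotalBudget} admits a polynomial-time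 approximation scheme: there is an algorithm that, given a rational number $\varepsilon>0$ (as numerator and denominator) and an instance $I$ with symmetric costs, computes an allocation $A$ of total cost at most $W$ such that $$(1+\varepsilon)\cdot|\{j : t_j \text{ is handled by } A\}|\ \ge\ \mathrm{opt}(I),$$ and such that for every fixed $\varepsilon$ there is a polynomial $p_\varepsilon$ for which the running time is at most $p_\varepsilon(|I|)$ on every instance $I$. Algorithms are programs of a random access machine, with the running time measured under the logarithmic cost criterion. -/

import Mathlib

/-!
# Multi-robot task allocation with a total budget, and a logarithmic-cost RAM
-/

/-! ### The allocation problem -/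

namespace TaskAllocation

/-- An instance `(R, T, q, C)` with a budget `W`: there are `n` robots and `m` tasks, task `j`
requires `q j` robots, and robot `i` incurs the non-negative rational cost `c i j` if it works on
task `j`. -/
structure Problem where
  n : ℕ
  m : ℕ
  q : Fin m → ℕ
  c : Fin n → Fin m → NNRat
  W : ℕ

namespace Problem

/-- An allocation gives at most one task to every robot. -/
abbrev Allocation (P : Problem) : Type := Fin P.n → Option (Fin P.m)

variable (P : Problem)

/-- The robots allocated to task `j`. -/
def robotsOf (A : P.Allocation) (j : Fin P.m) : Finset (Fin P.n) :=
  Finset.univ.filter fun i => A i = some j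

/-- The set of handled tasks: those that are allocated at least as many robots as they require. -/
def handled (A : P.Allocation) : Finset (Fin P.m) :=
  Finset.univ.filter fun j => P.q j ≤ (P.robotsOf A j).card

/-- The total cost of an allocation. -/
def totalCost (A : P.Allocation) : NNRat :=
  ∑ j, ∑ i ∈ P.robotsOf A j, P.c i j

/-- The constraint of MaxTaskWithinTotalBudget. -/
def WithinTotalBudget (A : P.Allocation) : Prop :=
  P.totalCost A ≤ (P.W : NNRat)

instance : DecidablePred P.WithinTotalBudget :=
  fun A => inferInstanceAs (Decidable (P.totalCost A ≤ (P.W : NNRat)))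

/-- The optimal value of MaxTaskWithinTotalBudget: the maximum number of tasks handled by an
allocation of total cost at most `W`. The allocation without any assigned robot always satisfies
the constraint, so that the maximum is over a non-empty finite set. -/
def opt : ℕ :=
  (Finset.univ.filter fun A : P.Allocation => P.WithinTotalBudget A).sup
    fun A => (P.handled A).card

/-- Symmetric costs: for each task, all robots have the same cost. -/
def SymmetricCosts : Prop :=
  ∀ (i k : Fin P.n) (j : Fin P.m), P.c i j = P.c k j

end Problem

/-- The data of an instance with symmetric costs: the costs are given by one number `c j` for each
task, and the robots only by their number. -/
structure SymProblem where
  n : ℕ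
  m : ℕ
  q : Fin m → ℕ
  c : Fin m → NNRat
  W : ℕ

namespace SymProblem

/-- The instance that is given by symmetric data. -/
def toProblem (I : SymProblem) : Problem where
  n := I.n
  m := I.m
  q := I.q
  c := fun _ j => I.c j
  W := I.W

/-- The instances with symmetric costs are exactly those that are given by symmetric data. -/
theorem symmetricCosts_iff (P : Problem) :
    P.SymmetricCosts ↔ ∃ I : SymProblem, I.toProblem = P := by
  constructor
  · intro h
    obtain ⟨n, m, q, c, W⟩ := P
    cases n with
    | zero =>
      refine ⟨⟨0, m, q, fun _ => 0, W⟩, ?_⟩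
      simp only [toProblem, Problem.mk.injEq, heq_eq_eq, true_and, and_true]
      funext i
      exact i.elim0
    | succ n =>
      refine ⟨⟨n + 1, m, q, c 0, W⟩, ?_⟩
      simp only [toProblem, Problem.mk.injEq, heq_eq_eq, true_and, and_true]
      funext i j
      exact h 0 i j
  · rintro ⟨I, rfl⟩ i k j
    rfl

/-- Symmetric data as a list of natural numbers: `n, m, W`, then the requirements, then the
numerators of the costs, then their denominators. -/
def encode (I : SymProblem) : List ℕ :=
  [I.n, I.m, I.W] ++ List.ofFn I.q ++ List.ofFn (fun j => (I.c j).num) ++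
    List.ofFn (fun j => (I.c j).den)

/-- The list `s₁, …, s_m, k₁, …, k_m` describes the allocation that gives to task `j` the
robots `i` with `s_j ≤ i < s_j + k_j`. -/
def Describes (I : SymProblem) (out : List ℕ) (A : I.toProblem.Allocation) : Prop :=
  ∃ s k : Fin I.m → ℕ, out = List.ofFn s ++ List.ofFn k ∧
    ∀ (i : Fin I.n) (j : Fin I.m), A i = some j ↔ s j ≤ (i : ℕ) ∧ (i : ℕ) < s j + k j

end SymProblem

/-- The length in bits of a list of natural numbers that are written in binary, with one
separator after each number. -/
def bitLength (l : List ℕ) : ℕ :=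
  (l.map fun a => Nat.size a + 1).sum

end TaskAllocation

/-! ### Random access machines under the logarithmic cost criterion -/

namespace RAM

/-- A memory consists of arrays `0, 1, 2, …` of natural numbers; `σ x i` is the content of
cell `i` of array `x`. A program mentions only finitely many arrays. -/
abbrev Memory : Type := ℕ → ℕ → ℕ

/-- Arithmetic expressions: constants, the content `x[i]` of a cell whose index is computed, and
the four operations (truncated subtraction, rounded down division). -/
inductive Expr : Type
  | lit (a : ℕ) : Expr
  | get (x : ℕ) (i : Expr) : Expr
  | add (e f : Expr) : Expr
  | sub (e f : Expr) : Expr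
  | mul (e f : Expr) : Expr
  | div (e f : Expr) : Expr

namespace Expr

/-- The value of an expression. -/
def eval (σ : Memory) : Expr → ℕ
  | lit a => a
  | get x i => σ x (i.eval σ)
  | add e f => e.eval σ + f.eval σ
  | sub e f => e.eval σ - f.eval σ
  | mul e f => e.eval σ * f.eval σ
  | div e f => e.eval σ / f.eval σ

/-- The time for the evaluation of an expression: every subexpression is charged `1` plus the
number of bits of its value. So an operation is charged for its operands and its result, and
a memory access for the index and the content of the cell. -/
def time (σ : Memory) : Expr → ℕ
  | lit a => 1 + Nat.size a
  | get x i => i.time σ + 1 + Nat.size (σ x (i.eval σ))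
  | add e f => e.time σ + f.time σ + 1 + Nat.size (e.eval σ + f.eval σ)
  | sub e f => e.time σ + f.time σ + 1 + Nat.size (e.eval σ - f.eval σ)
  | mul e f => e.time σ + f.time σ + 1 + Nat.size (e.eval σ * f.eval σ)
  | div e f => e.time σ + f.time σ + 1 + Nat.size (e.eval σ / f.eval σ)

end Expr

/-- Programs. `assign x i e` is `x[i] := e`; a test `e` succeeds if the value of `e` is not `0`. -/
inductive Prog : Type
  | skip : Prog
  | assign (x : ℕ) (i e : Expr) : Prog
  | seq (p r : Prog) : Prog
  | ite (e : Expr) (p r : Prog) : Prog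
  | loop (e : Expr) (p : Prog) : Prog

/-- The memory after `x[i] := a`. -/
def Memory.write (σ : Memory) (x i a : ℕ) : Memory :=
  fun y k => if y = x ∧ k = i then a else σ y k

/-- `Exec p σ t τ`: started in the memory `σ`, the program `p` halts after time `t` in the
memory `τ`. -/
inductive Exec : Prog → Memory → ℕ → Memory → Prop
  | skip (σ : Memory) : Exec Prog.skip σ 1 σ
  | assign (σ : Memory) (x : ℕ) (i e : Expr) :
      Exec (Prog.assign x i e) σ (1 + i.time σ + e.time σ) (σ.write x (i.eval σ) (e.eval σ))
  | seq {p r : Prog} {σ τ ρ : Memory} {s t : ℕ} :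
      Exec p σ s τ → Exec r τ t ρ → Exec (Prog.seq p r) σ (s + t) ρ
  | iteTrue {e : Expr} {p r : Prog} {σ τ : Memory} {t : ℕ} :
      e.eval σ ≠ 0 → Exec p σ t τ → Exec (Prog.ite e p r) σ (1 + e.time σ + t) τ
  | iteFalse {e : Expr} {p r : Prog} {σ τ : Memory} {t : ℕ} :
      e.eval σ = 0 → Exec r σ t τ → Exec (Prog.ite e p r) σ (1 + e.time σ + t) τ
  | loopStop {e : Expr} {p : Prog} {σ : Memory} :
      e.eval σ = 0 → Exec (Prog.loop e p) σ (1 + e.time σ) σ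
  | loopStep {e : Expr} {p : Prog} {σ τ ρ : Memory} {s t : ℕ} :
      e.eval σ ≠ 0 → Exec p σ s τ → Exec (Prog.loop e p) τ t ρ →
        Exec (Prog.loop e p) σ (1 + e.time σ + s + t) ρ

/-- Programs are deterministic. -/
theorem Exec.deterministic {p : Prog} {σ τ₁ τ₂ : Memory} {t₁ t₂ : ℕ}
    (h₁ : Exec p σ t₁ τ₁) (h₂ : Exec p σ t₂ τ₂) : t₁ = t₂ ∧ τ₁ = τ₂ := by
  induction h₁ generalizing t₂ τ₂ with
  | skip => cases h₂; exact ⟨rfl, rfl⟩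
  | assign => cases h₂; exact ⟨rfl, rfl⟩
  | seq _ _ ih₁ ih₂ =>
    cases h₂ with
    | seq a b =>
      obtain ⟨rfl, rfl⟩ := ih₁ a
      obtain ⟨rfl, rfl⟩ := ih₂ b
      exact ⟨rfl, rfl⟩
  | iteTrue h _ ih =>
    cases h₂ with
    | iteTrue _ a =>
      obtain ⟨rfl, rfl⟩ := ih a
      exact ⟨rfl, rfl⟩
    | iteFalse h' _ => exact absurd h' h
  | iteFalse h _ ih =>
    cases h₂ with
    | iteTrue h' _ => exact absurd h h'
    | iteFalse _ a =>
      obtain ⟨rfl, rfl⟩ := ih a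
      exact ⟨rfl, rfl⟩
  | loopStop h =>
    cases h₂ with
    | loopStop _ => exact ⟨rfl, rfl⟩
    | loopStep h' _ _ => exact absurd h h'
  | loopStep h _ _ ih₁ ih₂ =>
    cases h₂ with
    | loopStop h' => exact absurd h' h
    | loopStep _ a b =>
      obtain ⟨rfl, rfl⟩ := ih₁ a
      obtain ⟨rfl, rfl⟩ := ih₂ b
      exact ⟨rfl, rfl⟩

/-- The initial memory for the input `l`: cell `0` of array `0` holds the length of `l`, the next
cells of array `0` hold its entries, and all other cells hold `0`. -/
def input (l : List ℕ) : Memory :=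
  fun x i => if x = 0 then (l.length :: l).getD i 0 else 0

/-- The output in a final memory: the list whose length is in cell `0` of array `1` and whose
entries are in the next cells of array `1`. -/
def output (σ : Memory) : List ℕ :=
  (List.range (σ 1 0)).map fun i => σ 1 (i + 1)

/-- On input `inp`, the program `p` halts within time `t`, with output `out`. -/
def OutputsWithin (p : Prog) (inp out : List ℕ) (t : ℕ) : Prop :=
  ∃ (s : ℕ) (τ : Memory), Exec p (input inp) s τ ∧ s ≤ t ∧ output τ = out

end RAM

/-!
A set `S` of tasks can be handled within the budget if and only if the sum of the requirements
`q j` over `S` is at most `n` and the sum of `q j * c j` over `S` is at most `W`. So the problem is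
a knapsack problem with two constraints in which all items have the same profit. After
multiplication by the product of the denominators of the costs, all data are natural numbers.

**The approximation.** Let `K = ⌊1/ε⌋ + 1`. All sets of at most `K` tasks are enumerated, which
settles the case that the optimum is at most `K` (`exists_digits`). If the optimum is larger, then
one missing task does not matter, and dynamic programming finds a set that is smaller than the
optimum by at most one (`exists_table_entry`): the requirements are rounded up to multiples of
about `n / m²`, and for every size and every rounded total requirement the cheapest set is
computed. Rounding can make an optimal set `S` look infeasible, but not any more after the task of
`S` with the largest requirement, which is at least the average, has been removed
(`sum_rounded_erase_le`). The size and the rounded requirement of a set are packed into one number,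
the key, and so are its price and its bit pattern, the value. Thus the table is the one of a subset
sum problem: the smallest value for every key.

Every set that is proposed by one of the two parts is checked for feasibility, so that both parts
need only be complete. The tasks of the best set get consecutive intervals of robots
(`exists_allocation`).

**The running time.** Suppose that every number in the memory has at most `B` bits and that every
loop makes at most `R` rounds whenever it is reached. Then a program `p` takes time at most
`p.cost R * (B + 1)`, where `p.cost` is a polynomial that depends only on the text of `p`
(`exists_polynomial_cost`). The predicate `wp` combines this bound with total correctness, so that
the proof of correctness only has to bound the numbers that are stored and the rounds of the loops.
For a fixed `ε`, both `B` and `R` are polynomials in the length of the input (`bounds`): there are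
`(m + 2) ^ K` codes of small sets and `(m + 1) ^ 5` entries of the table.
-/

/-! ### Running times of programs with bounded loops -/

namespace RAM

namespace Expr

/-- A weight of an expression: the value has at most `weight e * (B + 1)` bits if all memory cells
have at most `B` bits. -/
def weight : Expr → ℕ
  | lit a => 1 + Nat.size a
  | get _ i => i.weight + 1
  | add e f => e.weight + f.weight + 1
  | sub e f => e.weight + f.weight + 1
  | mul e f => e.weight + f.weight + 1
  | div e f => e.weight + f.weight + 1

/-- The time for the evaluation of `e` is at most `cost e * (B + 1)` if all memory cells have at
most `B` bits. -/
def cost : Expr → ℕ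
  | lit a => 1 + Nat.size a
  | get _ i => i.cost + 1
  | add e f => e.cost + f.cost + (e.weight + f.weight + 2)
  | sub e f => e.cost + f.cost + (e.weight + f.weight + 2)
  | mul e f => e.cost + f.cost + (e.weight + f.weight + 2)
  | div e f => e.cost + f.cost + (e.weight + f.weight + 2)

end Expr

/-- Every memory cell holds a number of at most `B` bits. -/
def Fits (B : ℕ) (σ : Memory) : Prop := ∀ x i, σ x i < 2 ^ B

theorem size_add_le (a b : ℕ) : Nat.size (a + b) ≤ Nat.size a + Nat.size b + 1 := by
  rw [Nat.size_le]
  have ha := Nat.lt_size_self a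
  have hb := Nat.lt_size_self b
  have h1 : 2 ^ Nat.size a ≤ 2 ^ (Nat.size a + Nat.size b) :=
    Nat.pow_le_pow_right (by norm_num) (by omega)
  have h2 : 2 ^ Nat.size b ≤ 2 ^ (Nat.size a + Nat.size b) :=
    Nat.pow_le_pow_right (by norm_num) (by omega)
  rw [pow_succ]
  omega

theorem size_mul_le (a b : ℕ) : Nat.size (a * b) ≤ Nat.size a + Nat.size b := by
  rw [Nat.size_le, pow_add]
  exact Nat.mul_lt_mul'' (Nat.lt_size_self a) (Nat.lt_size_self b)

theorem Fits.size_eval_le {B : ℕ} {σ : Memory} (h : Fits B σ) (e : Expr) :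
    Nat.size (e.eval σ) ≤ e.weight * (B + 1) := by
  induction e with
  | lit a => simp only [Expr.eval, Expr.weight]; nlinarith
  | get x i _ =>
    have := Nat.size_le.2 (h x (i.eval σ))
    simp only [Expr.eval, Expr.weight]
    nlinarith
  | add e f he hf =>
    have := size_add_le (e.eval σ) (f.eval σ)
    simp only [Expr.eval, Expr.weight]
    nlinarith
  | sub e f he hf =>
    have := Nat.size_le_size (Nat.sub_le (e.eval σ) (f.eval σ))
    simp only [Expr.eval, Expr.weight]
    nlinarith
  | mul e f he hf =>
    have := size_mul_le (e.eval σ) (f.eval σ)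
    simp only [Expr.eval, Expr.weight]
    nlinarith
  | div e f he hf =>
    have := Nat.size_le_size (Nat.div_le_self (e.eval σ) (f.eval σ))
    simp only [Expr.eval, Expr.weight]
    nlinarith

theorem Fits.time_le {B : ℕ} {σ : Memory} (h : Fits B σ) (e : Expr) :
    e.time σ ≤ e.cost * (B + 1) := by
  induction e with
  | lit a => simp only [Expr.time, Expr.cost]; nlinarith
  | get x i hi =>
    have := Nat.size_le.2 (h x (i.eval σ))
    simp only [Expr.time, Expr.cost]
    nlinarith
  | add e f he hf =>
    have := h.size_eval_le (Expr.add e f)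
    simp only [Expr.time, Expr.cost, Expr.eval, Expr.weight] at *
    nlinarith
  | sub e f he hf =>
    have := h.size_eval_le (Expr.sub e f)
    simp only [Expr.time, Expr.cost, Expr.eval, Expr.weight] at *
    nlinarith
  | mul e f he hf =>
    have := h.size_eval_le (Expr.mul e f)
    simp only [Expr.time, Expr.cost, Expr.eval, Expr.weight] at *
    nlinarith
  | div e f he hf =>
    have := h.size_eval_le (Expr.div e f)
    simp only [Expr.time, Expr.cost, Expr.eval, Expr.weight] at *
    nlinarith

namespace Prog

/-- A bound for the running time of a program in units of `B + 1`, if all numbers have at most `B`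
bits and every loop makes at most `R` rounds whenever it is reached. -/
def cost (R : ℕ) : Prog → ℕ
  | skip => 1
  | assign _ i e => 1 + i.cost + e.cost
  | seq p r => p.cost R + r.cost R
  | ite e p r => 1 + e.cost + p.cost R + r.cost R
  | loop e p => (R + 1) * (1 + e.cost + p.cost R)

/-- The arrays to which a program may write. -/
def writes : Prog → List ℕ
  | skip => []
  | assign x _ _ => [x]
  | seq p r => p.writes ++ r.writes
  | ite _ p r => p.writes ++ r.writes
  | loop _ p => p.writes

theorem exists_polynomial_cost (p : Prog) :
    ∃ P : Polynomial ℕ, ∀ R, P.eval R = p.cost R := by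
  induction p with
  | skip => exact ⟨1, fun R => by simp [cost]⟩
  | assign x i e => exact ⟨(1 + i.cost + e.cost : ℕ), fun R => by simp [cost]⟩
  | seq p r hp hr =>
    obtain ⟨P, hP⟩ := hp
    obtain ⟨S, hS⟩ := hr
    exact ⟨P + S, fun R => by simp [cost, hP, hS]⟩
  | ite e p r hp hr =>
    obtain ⟨P, hP⟩ := hp
    obtain ⟨S, hS⟩ := hr
    exact ⟨(1 + e.cost : ℕ) + P + S, fun R => by simp [cost, hP, hS]⟩
  | loop e p hp =>
    obtain ⟨P, hP⟩ := hp
    exact ⟨(Polynomial.X + 1) * (Polynomial.C (1 + e.cost) + P), fun R => by simp [cost, hP]⟩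

end Prog

@[simp] theorem Memory.write_same (σ : Memory) (x i a : ℕ) :
    σ.write x i a x = Function.update (σ x) i a := by
  funext k
  simp [Memory.write, Function.update_apply]

@[simp] theorem Memory.write_of_ne (σ : Memory) {x y : ℕ} (i a : ℕ) (h : y ≠ x) :
    σ.write x i a y = σ y := by
  funext k
  simp [Memory.write, h]

theorem Fits.write {B : ℕ} {σ : Memory} (h : Fits B σ) (x i : ℕ) {a : ℕ} (ha : a < 2 ^ B) :
    Fits B (σ.write x i a) := by
  intro y k
  unfold Memory.write
  split_ifs
  · exact ha
  · exact h y k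

theorem Exec.eq_of_notMem_writes {p : Prog} {σ τ : Memory} {t : ℕ} (h : Exec p σ t τ) {x : ℕ}
    (hx : x ∉ p.writes) : τ x = σ x := by
  induction h with
  | skip => rfl
  | assign σ y i e =>
    simp only [Prog.writes, List.mem_singleton] at hx
    exact Memory.write_of_ne σ _ _ hx
  | seq _ _ h₁ h₂ =>
    simp only [Prog.writes, List.mem_append, not_or] at hx
    rw [h₂ hx.2, h₁ hx.1]
  | iteTrue _ _ h₁ =>
    simp only [Prog.writes, List.mem_append, not_or] at hx
    exact h₁ hx.1
  | iteFalse _ _ h₁ =>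
    simp only [Prog.writes, List.mem_append, not_or] at hx
    exact h₁ hx.2
  | loopStop _ => rfl
  | loopStep _ _ _ h₁ h₂ => rw [h₂ hx, h₁ hx]

/-- Total correctness with a resource bound: started in `σ`, the program halts in a memory with
property `Q`, all numbers that are stored have at most `B` bits, and the running time is at most
what `Prog.cost` predicts for loops of at most `R` rounds. -/
def wp (B R : ℕ) (p : Prog) (Q : Memory → Prop) (σ : Memory) : Prop :=
  Fits B σ → ∃ t τ, Exec p σ t τ ∧ t ≤ p.cost R * (B + 1) ∧ Fits B τ ∧ Q τ

section Rules

variable {B R : ℕ} {σ : Memory} {Q : Memory → Prop}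

theorem wp_of_fits {p : Prog} (h : Fits B σ → wp B R p Q σ) : wp B R p Q σ :=
  fun hσ => h hσ hσ

theorem wp_skip (h : Q σ) : wp B R Prog.skip Q σ :=
  fun hσ => ⟨1, σ, Exec.skip σ, by simp [Prog.cost], hσ, h⟩

theorem wp_assign {x : ℕ} {i e : Expr} (he : e.eval σ < 2 ^ B)
    (h : Q (σ.write x (i.eval σ) (e.eval σ))) : wp B R (Prog.assign x i e) Q σ := by
  intro hσ
  refine ⟨_, _, Exec.assign σ x i e, ?_, hσ.write _ _ he, h⟩
  have h1 := hσ.time_le i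
  have h2 := hσ.time_le e
  simp only [Prog.cost]
  nlinarith

theorem wp_seq {p r : Prog} (h : wp B R p (wp B R r Q) σ) : wp B R (Prog.seq p r) Q σ := by
  intro hσ
  obtain ⟨s, τ, hs, hsc, hτ, hr⟩ := h hσ
  obtain ⟨t, ρ, ht, htc, hρ, hQ⟩ := hr hτ
  refine ⟨_, _, Exec.seq hs ht, ?_, hρ, hQ⟩
  simp only [Prog.cost]
  nlinarith

theorem wp_ite {e : Expr} {p r : Prog} (hp : e.eval σ ≠ 0 → wp B R p Q σ)
    (hr : e.eval σ = 0 → wp B R r Q σ) : wp B R (Prog.ite e p r) Q σ := by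
  intro hσ
  have he := hσ.time_le e
  by_cases h : e.eval σ = 0
  · obtain ⟨t, τ, ht, htc, hτ, hQ⟩ := hr h hσ
    refine ⟨_, _, Exec.iteFalse h ht, ?_, hτ, hQ⟩
    simp only [Prog.cost]
    nlinarith
  · obtain ⟨t, τ, ht, htc, hτ, hQ⟩ := hp h hσ
    refine ⟨_, _, Exec.iteTrue h ht, ?_, hτ, hQ⟩
    simp only [Prog.cost]
    nlinarith

theorem wp.mono {p : Prog} {Q' : Memory → Prop} (h : wp B R p Q σ)
    (hQ : ∀ τ, (∀ x, x ∉ p.writes → τ x = σ x) → Q τ → Q' τ) : wp B R p Q' σ := by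
  intro hσ
  obtain ⟨t, τ, ht, htc, hτ, hQτ⟩ := h hσ
  exact ⟨t, τ, ht, htc, hτ, hQ τ (fun x hx => ht.eq_of_notMem_writes hx) hQτ⟩

/-- The content of cell `0` of array `x`, used as a scalar variable. -/
abbrev reg (x : ℕ) : Expr := Expr.get x (Expr.lit 0)

/-- `x := e` for a scalar variable `x`. -/
abbrev setReg (x : ℕ) (e : Expr) : Prog := Prog.assign x (Expr.lit 0) e

/-- `for v = 0, …, b - 1 do p`, where `v` and `b` are scalar variables. -/
def forLoop (v b : ℕ) (p : Prog) : Prog :=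
  Prog.seq (setReg v (Expr.lit 0)) (Prog.loop (Expr.sub (reg b) (reg v))
    (Prog.seq p (setReg v (Expr.add (reg v) (Expr.lit 1)))))

/-- The loop part of `forLoop`, entered when `k` of the `N` rounds are left. -/
theorem wp_loop_aux {v b N : ℕ} {p : Prog} (hNR : N < 2 ^ B) (hb : b ∉ p.writes)
    (hv : v ∉ p.writes) (hbv : b ≠ v) (σ₀ : Memory) (hN : σ₀ b 0 = N) (Inv : ℕ → Memory → Prop)
    (step : ∀ i τ, i < N → τ v 0 = i → (∀ x, x ∉ p.writes → x ≠ v → τ x = σ₀ x) → Inv i τ →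
      wp B R p (fun ρ => Inv (i + 1) (ρ.write v 0 (i + 1))) τ) (k : ℕ) :
    ∀ i τ, i + k = N → τ v 0 = i → (∀ x, x ∉ p.writes → x ≠ v → τ x = σ₀ x) → Inv i τ →
      Fits B τ → ∃ t ρ, Exec (Prog.loop (Expr.sub (reg b) (reg v))
        (Prog.seq p (setReg v (Expr.add (reg v) (Expr.lit 1))))) τ t ρ ∧
        t ≤ (k + 1) * (1 + (Expr.sub (reg b) (reg v)).cost +
          (Prog.seq p (setReg v (Expr.add (reg v) (Expr.lit 1)))).cost R) * (B + 1) ∧ Fits B ρ ∧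
        (∀ x, x ∉ p.writes → x ≠ v → ρ x = σ₀ x) ∧ Inv N ρ := by
  induction k with
  | zero =>
    intro i τ hi hvi hfr hInv hτ
    obtain rfl : i = N := by omega
    have hb' : τ b 0 = i := by rw [hfr b hb hbv, hN]
    refine ⟨_, τ, Exec.loopStop (by simp [Expr.eval, hvi, hb']), ?_, hτ, hfr, hInv⟩
    have := hτ.time_le (Expr.sub (reg b) (reg v))
    nlinarith
  | succ k ih =>
    intro i τ hi hvi hfr hInv hτ
    have hb' : τ b 0 = N := by rw [hfr b hb hbv, hN]
    have hbody : wp B R (Prog.seq p (setReg v (Expr.add (reg v) (Expr.lit 1))))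
        (fun ρ => Inv (i + 1) ρ ∧ ρ v 0 = i + 1 ∧ ∀ x, x ∉ p.writes → x ≠ v → ρ x = σ₀ x) τ := by
      refine wp_seq ((step i τ (by omega) hvi hfr hInv).mono ?_)
      intro ρ hρ hInvρ
      have hvρ : ρ v 0 = i := by rw [hρ v hv, hvi]
      refine wp_assign (by simp only [Expr.eval, hvρ]; omega) ?_
      simp only [Expr.eval, hvρ]
      refine ⟨hInvρ, by simp, fun x hx hxv => ?_⟩
      rw [Memory.write_of_ne _ _ _ hxv, hρ x hx, hfr x hx hxv]
    obtain ⟨s, ρ, hs, hsc, hρ, hInvρ, hvρ, hfrρ⟩ := hbody hτ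
    obtain ⟨t, π, ht, htc, hπ, hfrπ, hInvπ⟩ := ih (i + 1) ρ (by omega) hvρ hfrρ hInvρ hρ
    refine ⟨_, π, Exec.loopStep (by simp only [Expr.eval, hvi, hb']; omega) hs ht, ?_, hπ, hfrπ,
      hInvπ⟩
    have := hτ.time_le (Expr.sub (reg b) (reg v))
    nlinarith

/-- The invariant rule for `forLoop`. Only the arrays to which the body writes can change, so that
the invariant `Inv` need not mention the others. -/
theorem wp_forLoop {v b N : ℕ} {p : Prog} (hN : σ b 0 = N) (hNR : N ≤ R) (hNB : N < 2 ^ B)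
    (hb : b ∉ p.writes) (hv : v ∉ p.writes) (hbv : b ≠ v) (Inv : ℕ → Memory → Prop)
    (init : Inv 0 (σ.write v 0 0))
    (step : ∀ i τ, i < N → τ v 0 = i → (∀ x, x ∉ p.writes → x ≠ v → τ x = σ x) → Inv i τ →
      wp B R p (fun ρ => Inv (i + 1) (ρ.write v 0 (i + 1))) τ)
    (post : ∀ τ, (∀ x, x ∉ p.writes → x ≠ v → τ x = σ x) → Inv N τ → Q τ) :
    wp B R (forLoop v b p) Q σ := by
  refine wp_seq (wp_assign (by simp [Expr.eval]) fun hσ => ?_)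
  simp only [Expr.eval] at hσ ⊢
  obtain ⟨t, ρ, ht, htc, hρ, hfr, hInv⟩ := wp_loop_aux hNB hb hv hbv σ hN Inv step N 0 _ (by omega)
    (by simp) (fun x _ hx => Memory.write_of_ne _ _ _ hx) init hσ
  refine ⟨t, ρ, ht, htc.trans (Nat.mul_le_mul_right _ ?_), hρ, post ρ hfr hInv⟩
  exact Nat.mul_le_mul_right _ (by omega)

end Rules

end RAM

/-! ### Sets of tasks as bit patterns -/

namespace TaskAllocation

open Finset

/-- The binary digit of `x` at position `j`. The number `x` represents the set of the tasks `j < m`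
with `bit x j = 1`; the digits at other positions are ignored. -/
def bit (x j : ℕ) : ℕ := x / 2 ^ j % 2

theorem bit_le_one (x j : ℕ) : bit x j ≤ 1 := by
  unfold bit
  omega

/-- The part `a * 2 ^ m` will be a price, which is stored above the bit pattern of a set. -/
theorem bit_mask {m : ℕ} (S : Finset ℕ) (a : ℕ) {j : ℕ} (hj : j < m) :
    bit (a * 2 ^ m + ∑ i ∈ S, 2 ^ i) j = if j ∈ S then 1 else 0 := by
  have hlow : ∑ i ∈ S with i < j, 2 ^ i < 2 ^ j :=
    Nat.geomSum_lt le_rfl fun k hk => (mem_filter.1 hk).2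
  obtain ⟨t, ht⟩ : 2 ^ (j + 1) ∣ ∑ i ∈ S with j < i, 2 ^ i :=
    dvd_sum fun i hi => pow_dvd_pow 2 (mem_filter.1 hi).2
  obtain ⟨r, hr⟩ : 2 ^ (j + 1) ∣ a * 2 ^ m := (pow_dvd_pow 2 hj).mul_left a
  have hsplit : ∑ i ∈ S, 2 ^ i =
      ∑ i ∈ S with i < j, 2 ^ i + ((if j ∈ S then 2 ^ j else 0) + ∑ i ∈ S with j < i, 2 ^ i) := by
    rw [← sum_filter_add_sum_filter_not S (· < j)]
    congr 1
    rw [← sum_filter_add_sum_filter_not (S.filter (¬ · < j)) (· = j), filter_filter, filter_filter]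
    congr 1
    · rw [← sum_ite_eq' S j fun i => 2 ^ i, ← sum_filter]
      exact sum_congr (filter_congr fun i _ => by omega) fun _ _ => rfl
    · exact sum_congr (filter_congr fun i _ => by omega) fun _ _ => rfl
  have key : a * 2 ^ m + ∑ i ∈ S, 2 ^ i =
      ∑ i ∈ S with i < j, 2 ^ i + 2 ^ j * ((if j ∈ S then 1 else 0) + 2 * (r + t)) := by
    rw [hsplit, ht, hr, pow_succ]
    split_ifs <;> ring
  rw [bit, key, Nat.add_mul_div_left _ _ (by positivity), Nat.div_eq_of_lt hlow]
  split_ifs <;> omega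

theorem sum_bit_mask {m : ℕ} {S : Finset ℕ} (hS : S ⊆ range m) (a : ℕ) (f : ℕ → ℕ) :
    ∑ j ∈ range m, bit (a * 2 ^ m + ∑ i ∈ S, 2 ^ i) j * f j = ∑ j ∈ S, f j := by
  rw [← sum_subset hS fun j hj hjS => by
    rw [bit_mask S a (mem_range.1 hj), if_neg hjS, zero_mul]]
  exact sum_congr rfl fun j hj => by
    rw [bit_mask S a (mem_range.1 (hS hj)), if_pos hj, one_mul]

/-- The digit `d + 1` with `d < m` stands for the bit pattern of `{d}`, the digits `0` and `m + 1`
stand for the empty set. -/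
def digitMask (m d : ℕ) : ℕ := if 1 ≤ d ∧ d ≤ m then 2 ^ (d - 1) else 0

/-- The sum of the bit patterns given by the digits of `i` in base `m + 2`. The base is at least `2`
even for `m = 0`, so that the recursion ends. -/
def digitsMask (m i : ℕ) : ℕ :=
  if h : i = 0 then 0 else
    have : i / (m + 2) < i := Nat.div_lt_self (by omega) (by omega)
    digitsMask m (i / (m + 2)) + digitMask m (i % (m + 2))

theorem digitsMask_zero (m : ℕ) : digitsMask m 0 = 0 := by
  rw [digitsMask, dif_pos rfl]

theorem digitsMask_eq (m i : ℕ) :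
    digitsMask m i = digitsMask m (i / (m + 2)) + digitMask m (i % (m + 2)) := by
  by_cases h : i = 0
  · subst h
    simp [digitsMask_zero, digitMask]
  · rw [digitsMask, dif_neg h]

theorem digitMask_le (m d : ℕ) : digitMask m d ≤ 2 ^ m := by
  unfold digitMask
  split_ifs
  · exact Nat.pow_le_pow_right (by norm_num) (by omega)
  · exact Nat.zero_le _

theorem digitsMask_le (m i : ℕ) : digitsMask m i ≤ i * 2 ^ m := by
  induction i using Nat.strong_induction_on with
  | _ i ih =>
    rcases Nat.eq_zero_or_pos i with rfl | hi
    · simp [digitsMask_zero]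
    · have hlt : i / (m + 2) < i := Nat.div_lt_self hi (by omega)
      rw [digitsMask_eq]
      calc _ ≤ i / (m + 2) * 2 ^ m + 2 ^ m := add_le_add (ih _ hlt) (digitMask_le m _)
        _ = (i / (m + 2) + 1) * 2 ^ m := by ring
        _ ≤ i * 2 ^ m := Nat.mul_le_mul_right _ hlt

/-- Every set of at most `K` tasks is given by a number with `K` digits. -/
theorem exists_digitsMask_eq {m : ℕ} (K : ℕ) :
    ∀ {S : Finset ℕ}, S ⊆ range m → #S ≤ K →
      ∃ i < (m + 2) ^ K, digitsMask m i = ∑ j ∈ S, 2 ^ j := by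
  induction K with
  | zero =>
    intro S _ hK
    obtain rfl : S = ∅ := card_eq_zero.1 (by omega)
    exact ⟨0, by simp, by simp [digitsMask_zero]⟩
  | succ K ih =>
    intro S hS hK
    rcases S.eq_empty_or_nonempty with rfl | ⟨d, hd⟩
    · exact ⟨0, by positivity, by simp [digitsMask_zero]⟩
    · obtain ⟨i, hi, hiS⟩ := ih ((erase_subset d S).trans hS)
        (by rw [card_erase_of_mem hd]; omega)
      have hdm : d < m := mem_range.1 (hS hd)
      refine ⟨(m + 2) * i + (d + 1), ?_, ?_⟩
      · rw [pow_succ]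
        nlinarith
      · rw [digitsMask_eq, Nat.mul_add_div (by omega), Nat.mul_add_mod,
          Nat.div_eq_of_lt (by omega), Nat.mod_eq_of_lt (by omega : d + 1 < m + 2), add_zero, hiS,
          digitMask, if_pos (by omega), ← sum_erase_add _ _ hd]
        rfl

/-! ### Integral data and the knapsack table -/

/-- An instance with symmetric costs and a number `num / den` in the role of `ε`, all given by
natural numbers: the cost of task `j` is `c j / d j`. -/
structure Data where
  num : ℕ
  den : ℕ
  n : ℕ
  m : ℕ
  W : ℕ
  q : ℕ → ℕ
  c : ℕ → ℕ
  d : ℕ → ℕ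

namespace Data

variable (I : Data)

/-- A common denominator of the costs. -/
def commonDen : ℕ := ∏ j ∈ range I.m, I.d j

/-- The cost of `q j` robots at task `j`, multiplied by the common denominator. -/
def price (j : ℕ) : ℕ := I.q j * I.c j * (I.commonDen / I.d j)

/-- The budget, multiplied by the common denominator. -/
def budget : ℕ := I.W * I.commonDen

/-- Up to this number of tasks, the optimum is found by enumeration. -/
def small : ℕ := I.den / I.num + 1

/-- A strict upper bound for the requirement of task `j` in units of `(n + 1) / m²`: it is rounded
down, and `1` is added. -/
def rounded (j : ℕ) : ℕ := I.q j * (I.m * I.m) / (I.n + 1) + 1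

/-- A number larger than all sums of rounded requirements of tasks that can be handled. -/
def base : ℕ := (I.m + 1) * (I.m + 1) * (I.m + 1)

/-- A number larger than all keys of sets that can be handled, hence the length of a row of the
table. -/
def width : ℕ := (I.m + 1) * I.base

/-- The key of a task. In base `base`, the key of a set of tasks shows its size and its
rounded requirement. -/
def key (j : ℕ) : ℕ := I.base + I.rounded j

/-- The value that the table minimizes: its leading part is the price, its last `m` binary digits
tell the task. -/
def value (j : ℕ) : ℕ := I.price j * 2 ^ I.m + 2 ^ j

/-- The entry for the key `k` obtained from the row `T` of the table by adding task `j`, or `0`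
if this is not possible. -/
def extend (T : ℕ → ℕ) (j k : ℕ) : ℕ :=
  if I.key j ≤ k ∧ I.q j ≤ I.n ∧ T (k - I.key j) ≠ 0 then T (k - I.key j) + I.value j else 0

/-- The better one of two table entries, where `0` stands for a missing entry. -/
def better (s t : ℕ) : ℕ := if t ≠ 0 ∧ (s = 0 ∨ t < s) then t else s

/-- The entry `table j k` is `1` plus the smallest value of a set of tasks below `j` with key `k`
in which no task requires more than `n` robots; it is `0` if there is no such set. -/
def table : ℕ → ℕ → ℕ
  | 0, k => if k = 0 then 1 else 0
  | j + 1, k => better (table j k) (I.extend (table j) j k)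

/-- The entries of the table belong to sets. -/
theorem exists_of_table_ne_zero (j : ℕ) : ∀ k, I.table j k ≠ 0 →
    ∃ S ⊆ range j, (∀ i ∈ S, I.q i ≤ I.n) ∧ ∑ i ∈ S, I.key i = k ∧
      I.table j k = ∑ i ∈ S, I.value i + 1 := by
  induction j with
  | zero =>
    intro k hk
    have h0 : k = 0 := by
      by_contra h
      simp [table, h] at hk
    exact ⟨∅, by simp, by simp, by simp [h0], by simp [table, h0]⟩
  | succ j ih =>
    intro k hk
    rw [table, better] at hk ⊢
    split_ifs at hk ⊢ with h
    · obtain ⟨h, -⟩ := h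
      rw [extend] at h ⊢
      split_ifs at h ⊢ with h'
      · obtain ⟨S, hS, hSq, hSk, hST⟩ := ih _ h'.2.2
        have hj : j ∉ S := fun hj => by simpa using hS hj
        refine ⟨insert j S, ?_, ?_, ?_, ?_⟩
        · rw [range_add_one]
          exact insert_subset_insert j hS
        · intro i hi
          rcases mem_insert.1 hi with rfl | hi
          · exact h'.2.1
          · exact hSq i hi
        · rw [sum_insert hj, hSk]
          omega
        · rw [sum_insert hj, hST]
          omega
      · exact absurd rfl h
    · obtain ⟨S, hS, hSq, hSk, hST⟩ := ih k hk
      exact ⟨S, hS.trans (range_mono (Nat.le_succ j)), hSq, hSk, hST⟩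

/-- The entries of the table are minimal. -/
theorem table_le (j : ℕ) : ∀ {S : Finset ℕ}, S ⊆ range j → (∀ i ∈ S, I.q i ≤ I.n) →
    I.table j (∑ i ∈ S, I.key i) ≠ 0 ∧
      I.table j (∑ i ∈ S, I.key i) ≤ ∑ i ∈ S, I.value i + 1 := by
  induction j with
  | zero =>
    intro S hS _
    obtain rfl : S = ∅ := by simpa using hS
    simp [table]
  | succ j ih =>
    intro S hS hq
    by_cases hj : j ∈ S
    · have hS' : S.erase j ⊆ range j := by
        intro i hi
        have h1 := mem_range.1 (hS (mem_of_mem_erase hi))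
        have h2 := ne_of_mem_erase hi
        exact mem_range.2 (by omega)
      obtain ⟨h0, h1⟩ := ih hS' fun i hi => hq i (mem_of_mem_erase hi)
      have hk := sum_erase_add S I.key hj
      have hv := sum_erase_add S I.value hj
      have hext : I.extend (I.table j) j (∑ i ∈ S, I.key i) =
          I.table j (∑ i ∈ S.erase j, I.key i) + I.value j := by
        rw [extend, ← hk, Nat.add_sub_cancel, if_pos ⟨Nat.le_add_left _ _, hq j hj, h0⟩]
      rw [table, better, hext]
      split_ifs <;> omega
    · have hS' : S ⊆ range j := by
        intro i hi
        have h1 := mem_range.1 (hS hi)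
        have h2 : i ≠ j := fun h => hj (h ▸ hi)
        exact mem_range.2 (by omega)
      obtain ⟨h0, h1⟩ := ih hS' hq
      rw [table, better]
      split_ifs <;> omega

theorem table_le_sum {j : ℕ} (hj : j ≤ I.m) (k : ℕ) :
    I.table j k ≤ ∑ i ∈ range I.m, I.value i + 1 := by
  by_cases h : I.table j k = 0
  · omega
  · obtain ⟨S, hS, -, -, hT⟩ := I.exists_of_table_ne_zero j k h
    rw [hT]
    exact Nat.add_le_add_right (sum_le_sum_of_subset (hS.trans (range_mono hj))) 1

/-- The number of tasks in the set that is represented by `x`. -/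
def count (x : ℕ) : ℕ := ∑ j ∈ range I.m, bit x j

/-- The number of robots required by the tasks in the set that is represented by `x`. -/
def load (x : ℕ) : ℕ := ∑ j ∈ range I.m, bit x j * I.q j

/-- The price of the set that is represented by `x`. -/
def cost (x : ℕ) : ℕ := ∑ j ∈ range I.m, bit x j * I.price j

/-- The tasks in the set that is represented by `x` can be handled together. -/
def Feasible (x : ℕ) : Prop := I.load x ≤ I.n ∧ I.cost x ≤ I.budget

theorem count_mask {S : Finset ℕ} (hS : S ⊆ range I.m) (a : ℕ) :
    I.count (a * 2 ^ I.m + ∑ i ∈ S, 2 ^ i) = #S := by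
  simpa [count] using sum_bit_mask hS a fun _ => 1

theorem load_mask {S : Finset ℕ} (hS : S ⊆ range I.m) (a : ℕ) :
    I.load (a * 2 ^ I.m + ∑ i ∈ S, 2 ^ i) = ∑ i ∈ S, I.q i :=
  sum_bit_mask hS a _

theorem cost_mask {S : Finset ℕ} (hS : S ⊆ range I.m) (a : ℕ) :
    I.cost (a * 2 ^ I.m + ∑ i ∈ S, 2 ^ i) = ∑ i ∈ S, I.price i :=
  sum_bit_mask hS a _

theorem sum_rounded_lt_base {S : Finset ℕ} (hS : S ⊆ range I.m) (hq : ∀ i ∈ S, I.q i ≤ I.n) :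
    ∑ i ∈ S, I.rounded i < I.base := by
  have hcard : #S ≤ I.m := by simpa using card_le_card hS
  have h1 : ∑ i ∈ S, I.rounded i ≤ #S • (I.m * I.m + 1) := by
    refine sum_le_card_nsmul _ _ _ fun i hi => Nat.add_le_add_right ?_ 1
    refine Nat.div_le_of_le_mul ?_
    exact Nat.mul_le_mul_right _ ((hq i hi).trans (Nat.le_succ _))
  rw [smul_eq_mul] at h1
  refine h1.trans_lt ?_
  unfold base
  nlinarith [Nat.mul_le_mul_right (I.m * I.m + 1) hcard]

theorem sum_key (S : Finset ℕ) :
    ∑ i ∈ S, I.key i = I.base * #S + ∑ i ∈ S, I.rounded i := by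
  simp [key, sum_add_distrib, mul_comm]

/-- A set of tasks whose rounded requirement is at most `m²` requires at most `n` robots. -/
theorem sum_le_of_sum_rounded_le {S : Finset ℕ}
    (h : ∑ i ∈ S, I.rounded i ≤ I.m * I.m) : ∑ i ∈ S, I.q i ≤ I.n := by
  rcases S.eq_empty_or_nonempty with rfl | hne
  · simp
  · have hlt : ∀ i, I.q i * (I.m * I.m) < I.rounded i * (I.n + 1) := fun i =>
      Nat.lt_mul_of_div_lt (Nat.lt_succ_self _) (Nat.succ_pos _)
    have h1 : (∑ i ∈ S, I.q i) * (I.m * I.m) < (∑ i ∈ S, I.rounded i) * (I.n + 1) := by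
      rw [sum_mul, sum_mul]
      exact sum_lt_sum_of_nonempty hne fun i _ => hlt i
    have h2 := Nat.mul_le_mul_right (I.n + 1) h
    by_contra hcon
    have h3 := Nat.mul_le_mul_right (I.m * I.m) (not_le.1 hcon)
    simp only [Nat.succ_eq_add_one] at h3
    nlinarith

/-- After removal of a task with the largest requirement, the rounding does no harm: among `k` tasks
that require `n` robots together, this task requires at least `n / k` of them, while the rounding
costs less than `k * n / m²`. -/
theorem sum_rounded_erase_le {S : Finset ℕ} (hS : S ⊆ range I.m) (hq : ∑ i ∈ S, I.q i ≤ I.n)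
    {r : ℕ} (hr : r ∈ S) (hmax : ∀ i ∈ S, I.q i ≤ I.q r) :
    ∑ i ∈ S.erase r, I.rounded i ≤ I.m * I.m := by
  have hcard : #S ≤ I.m := by simpa using card_le_card hS
  obtain ⟨k, hk⟩ : ∃ k, #S = k + 1 := ⟨#S - 1, by have := card_pos.2 ⟨r, hr⟩; omega⟩
  have hk' : #(S.erase r) = k := by rw [card_erase_of_mem hr]; omega
  set M := I.m * I.m with hM
  set F := ∑ i ∈ S.erase r, I.q i * M / (I.n + 1) with hF
  set Q := ∑ i ∈ S.erase r, I.q i with hQ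
  have hsum : ∑ i ∈ S.erase r, I.rounded i = F + k := by
    simp only [rounded, sum_add_distrib, ← hM, ← hF, sum_const, smul_eq_mul, mul_one, hk']
  have hQr : Q + I.q r ≤ I.n := by rwa [hQ, sum_erase_add _ _ hr]
  have hQk : Q ≤ k * I.q r := by
    have := sum_le_card_nsmul (S.erase r) I.q (I.q r) fun i hi => hmax i (mem_of_mem_erase hi)
    rwa [hk', smul_eq_mul] at this
  have hFQ : F * (I.n + 1) ≤ Q * M := by
    rw [hF, hQ, sum_mul, sum_mul]
    exact sum_le_sum fun i _ => Nat.div_mul_le_self _ _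
  have hkQ : (k + 1) * Q ≤ k * I.n := by nlinarith
  have h1 : ((k + 1) * F) * (I.n + 1) ≤ (k * M) * (I.n + 1) := by
    calc ((k + 1) * F) * (I.n + 1) = (k + 1) * (F * (I.n + 1)) := by ring
      _ ≤ (k + 1) * (Q * M) := Nat.mul_le_mul_left _ hFQ
      _ = (k + 1) * Q * M := by ring
      _ ≤ k * I.n * M := Nat.mul_le_mul_right _ hkQ
      _ ≤ (k * M) * (I.n + 1) := by nlinarith [Nat.zero_le (k * M)]
  have h2 : (k + 1) * F ≤ k * M := Nat.le_of_mul_le_mul_right h1 (Nat.succ_pos _)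
  have h3 : (k + 1) * k ≤ M := Nat.mul_le_mul (by omega) (by omega)
  rw [hsum]
  refine Nat.le_of_mul_le_mul_left ?_ (Nat.succ_pos k)
  simp only [Nat.succ_eq_add_one]
  nlinarith

/-- The table misses the optimum by at most one task. -/
theorem exists_table_entry {S : Finset ℕ} (hS : S ⊆ range I.m) (hq : ∑ i ∈ S, I.q i ≤ I.n)
    (hp : ∑ i ∈ S, I.price i ≤ I.budget) (hne : S.Nonempty) :
    ∃ k < I.width, I.Feasible (I.table I.m k - 1) ∧ #S ≤ I.count (I.table I.m k - 1) + 1 := by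
  obtain ⟨r, hr, hmax⟩ := exists_max_image S I.q hne
  have hS' : S.erase r ⊆ range I.m := (erase_subset r S).trans hS
  have hSq : ∀ i ∈ S, I.q i ≤ I.n := fun i hi =>
    (single_le_sum (fun _ _ => Nat.zero_le _) hi).trans hq
  have hSq' : ∀ i ∈ S.erase r, I.q i ≤ I.n := fun i hi => hSq i (mem_of_mem_erase hi)
  have hround := I.sum_rounded_erase_le hS hq hr hmax
  have hbase := I.sum_rounded_lt_base hS' hSq'
  obtain ⟨h0, hle⟩ := I.table_le I.m hS' hSq'
  obtain ⟨T, hT, hTq, hTk, hTv⟩ := I.exists_of_table_ne_zero I.m _ h0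
  have hbaseT := I.sum_rounded_lt_base hT hTq
  have hpos : 0 < I.base := by unfold base; positivity
  -- The rounded requirements are below `base`, so that equal keys mean equal sizes.
  rw [sum_key, sum_key] at hTk
  have hcard : #T = #(S.erase r) := by
    have := congrArg (· / I.base) hTk
    simpa [Nat.mul_add_div hpos, Nat.div_eq_of_lt hbase, Nat.div_eq_of_lt hbaseT] using this
  have hTround : ∑ i ∈ T, I.rounded i ≤ I.m * I.m := by
    rw [hcard] at hTk
    omega
  have hval : ∀ U : Finset ℕ,
      ∑ i ∈ U, I.value i = (∑ i ∈ U, I.price i) * 2 ^ I.m + ∑ i ∈ U, 2 ^ i := fun U =>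
    by simp [value, sum_add_distrib, sum_mul]
  have hlow : ∑ i ∈ S.erase r, 2 ^ i < 2 ^ I.m :=
    Nat.geomSum_lt le_rfl fun k hk => mem_range.1 (hS' hk)
  -- The bit patterns are below `2 ^ m`, so that a smaller value means no larger price.
  have hprice : ∑ i ∈ T, I.price i ≤ ∑ i ∈ S.erase r, I.price i := by
    rw [hTv, hval, hval] at hle
    by_contra hcon
    have := Nat.mul_le_mul_right (2 ^ I.m) (not_le.1 hcon)
    simp only [Nat.succ_eq_add_one, add_mul] at this
    omega
  refine ⟨∑ i ∈ S.erase r, I.key i, ?_, ?_⟩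
  · have hcm : #(S.erase r) ≤ I.m := by simpa using card_le_card hS'
    rw [sum_key, width]
    nlinarith [Nat.mul_le_mul_left I.base hcm]
  · rw [hTv, Nat.add_sub_cancel, Feasible, hval, I.load_mask hT, I.cost_mask hT, I.count_mask hT]
    refine ⟨⟨I.sum_le_of_sum_rounded_le hTround, hprice.trans (le_trans ?_ hp)⟩, ?_⟩
    · exact sum_le_sum_of_subset (erase_subset r S)
    · rw [hcard, card_erase_of_mem hr]
      omega

/-- Small sets of tasks are found by enumeration. -/
theorem exists_digits {S : Finset ℕ} (hS : S ⊆ range I.m) (hq : ∑ i ∈ S, I.q i ≤ I.n)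
    (hp : ∑ i ∈ S, I.price i ≤ I.budget) (hcard : #S ≤ I.small) :
    ∃ i < (I.m + 2) ^ I.small, I.Feasible (digitsMask I.m i) ∧
      I.count (digitsMask I.m i) = #S := by
  obtain ⟨i, hi, h⟩ := exists_digitsMask_eq I.small hS hcard
  have h' : digitsMask I.m i = 0 * 2 ^ I.m + ∑ j ∈ S, 2 ^ j := by rw [h]; ring
  refine ⟨i, hi, ?_⟩
  rw [h', Feasible, I.load_mask hS, I.cost_mask hS, I.count_mask hS]
  exact ⟨⟨hq, hp⟩, rfl⟩

end Data

end TaskAllocation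

/-! ### The algorithm -/

-- Names for the arrays of the program. Those with the prefix `r` serve as scalar variables.

-- The input and the output.
local notation "aIn" => 0
local notation "aOut" => 1

-- The number of tasks, the common denominator, the powers of two (indexed by digits, as in
-- `TaskAllocation.digitMask`), the prices, the budget, and `2 ^ m`.
local notation "rTasks" => 2
local notation "rDen" => 3
local notation "aMask" => 4
local notation "aPrice" => 5
local notation "rBudget" => 19
local notation "rPow" => 20

-- The variables of inner and outer loops.
local notation "rJ" => 6
local notation "rI" => 7

-- The maximal size of small sets, the number of their codes, and their bit patterns.
local notation "rSmall" => 8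
local notation "rCodes" => 9
local notation "aList" => 10

-- A set that is to be checked, its size, its requirement and its price, and the best set so far.
local notation "rX" => 11
local notation "rCount" => 12
local notation "rLoad" => 13
local notation "rCost" => 14
local notation "rBest" => 15
local notation "rBestX" => 16

-- The table, the length of its rows, the place of the last row, the row and the key of the current
-- entry, the key of the current task, and a new entry.
local notation "aTable" => 18
local notation "rWidth" => 17
local notation "rEnd" => 24
local notation "rRow" => 21
local notation "rKey" => 22
local notation "rShift" => 23
local notation "rNew" => 25

-- The number of robots that have been assigned.
local notation "rSum" => 26

namespace RAM

section Program

open RAM.Expr RAM.Prog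

local instance : Add Expr := ⟨Expr.add⟩
local instance : Sub Expr := ⟨Expr.sub⟩
local instance : Mul Expr := ⟨Expr.mul⟩
local instance : Div Expr := ⟨Expr.div⟩

local infixr:60 " ;; " => Prog.seq

/-- The requirement of a task in the input. -/
def reqExpr (j : Expr) : Expr := get aIn (lit 6 + j)

/-- The numerator of the cost of a task in the input. -/
def numExpr (j : Expr) : Expr := get aIn (lit 6 + reg rTasks + j)

/-- The denominator of the cost of a task in the input. -/
def denExpr (j : Expr) : Expr := get aIn (lit 6 + reg rTasks + reg rTasks + j)

/-- The binary digit of `x` at position `j < m`. -/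
def bitExpr (x j : Expr) : Expr :=
  x / get aMask (j + lit 1) - x / get aMask (j + lit 1) / lit 2 * lit 2

/-- One more factor of the common denominator, one more power of two. -/
def initLoop : Prog :=
  setReg rDen (reg rDen * denExpr (reg rJ)) ;;
  assign aMask (reg rJ + lit 1) (reg rPow) ;;
  setReg rPow (reg rPow * lit 2)

/-- The price of one more task. -/
def priceLoop : Prog :=
  assign aPrice (reg rJ)
    (reqExpr (reg rJ) * numExpr (reg rJ) * (reg rDen / denExpr (reg rJ)))

/-- One more factor `m + 2` of the number of codes. -/
def powerLoop : Prog := setReg rCodes (reg rCodes * (reg rTasks + lit 2))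

/-- Computes the powers of two, the common denominator, the prices and the budget. -/
def prepare : Prog :=
  setReg rTasks (get aIn (lit 4)) ;;
  setReg rDen (lit 1) ;;
  setReg rPow (lit 1) ;;
  forLoop rJ rTasks initLoop ;;
  forLoop rJ rTasks priceLoop ;;
  setReg rBudget (get aIn (lit 5) * reg rDen)

/-- Adds the contribution of one task to the size, the requirement and the price of a set. -/
def checkLoop : Prog :=
  setReg rCount (reg rCount + bitExpr (reg rX) (reg rJ)) ;;
  setReg rLoad (reg rLoad + bitExpr (reg rX) (reg rJ) * reqExpr (reg rJ)) ;;
  setReg rCost (reg rCost + bitExpr (reg rX) (reg rJ) * get aPrice (reg rJ))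

/-- Replaces the best set that is known by the one in `rX` if that is feasible and larger. As
subtraction is truncated, the product in the test is not `0` if and only if `best < count`,
`load ≤ n` and `cost ≤ budget`. -/
def check : Prog :=
  setReg rCount (lit 0) ;;
  setReg rLoad (lit 0) ;;
  setReg rCost (lit 0) ;;
  forLoop rJ rTasks checkLoop ;;
  ite ((reg rCount - reg rBest) * (get aIn (lit 3) + lit 1 - reg rLoad) *
      (reg rBudget + lit 1 - reg rCost))
    (setReg rBest (reg rCount) ;; setReg rBestX (reg rX)) skip

/-- Computes and checks the bit pattern of one more code. The one of the code without its last
digit is known. -/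
def enumerateLoop : Prog :=
  assign aList (reg rI) (get aList (reg rI / (reg rTasks + lit 2)) +
    get aMask (reg rI - reg rI / (reg rTasks + lit 2) * (reg rTasks + lit 2))) ;;
  setReg rX (get aList (reg rI)) ;;
  check

/-- Checks all small sets. -/
def enumerate : Prog :=
  setReg rSmall (get aIn (lit 2) / get aIn (lit 1) + lit 1) ;;
  setReg rCodes (lit 1) ;;
  forLoop rJ rSmall powerLoop ;;
  forLoop rI rCodes enumerateLoop

/-- Computes the entry that is one row below the entry with number `rI`. The test of the first
conditional is the condition in `TaskAllocation.Data.extend`, the one of the second is the condition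
in `TaskAllocation.Data.better`. -/
def tableLoop : Prog :=
  setReg rRow (reg rI / reg rWidth) ;;
  setReg rKey (reg rI - reg rRow * reg rWidth) ;;
  setReg rShift ((reg rTasks + lit 1) * (reg rTasks + lit 1) * (reg rTasks + lit 1) +
    (reqExpr (reg rRow) * (reg rTasks * reg rTasks) / (get aIn (lit 3) + lit 1) + lit 1)) ;;
  assign aTable (reg rWidth + reg rI) (get aTable (reg rI)) ;;
  ite ((reg rKey + lit 1 - reg rShift) * (get aIn (lit 3) + lit 1 - reqExpr (reg rRow)) *
      get aTable (reg rI - reg rShift))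
    (setReg rNew (get aTable (reg rI - reg rShift) +
        (get aPrice (reg rRow) * reg rPow + get aMask (reg rRow + lit 1))) ;;
      ite ((lit 1 - get aTable (reg rI)) + (get aTable (reg rI) - reg rNew))
        (assign aTable (reg rWidth + reg rI) (reg rNew)) skip)
    skip

/-- Computes the table row by row: the entry with key `k` in row `j` is stored in the cell
`j * width + k`. -/
def fillTable : Prog :=
  setReg rWidth ((reg rTasks + lit 1) *
    ((reg rTasks + lit 1) * (reg rTasks + lit 1) * (reg rTasks + lit 1))) ;;
  setReg rEnd (reg rTasks * reg rWidth) ;;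
  assign aTable (lit 0) (lit 1) ;;
  forLoop rI rEnd tableLoop

/-- Checks one entry of the last row. A missing entry yields the empty set, as `0 - 1 = 0`. -/
def scanLoop : Prog :=
  setReg rX (get aTable (reg rEnd + reg rI) - lit 1) ;;
  check

/-- Checks all sets in the last row of the table. -/
def scanTable : Prog := forLoop rI rWidth scanLoop

/-- The interval of robots of one task. -/
def answerLoop : Prog :=
  setReg rCount (bitExpr (reg rBestX) (reg rJ) * reqExpr (reg rJ)) ;;
  assign aOut (reg rJ + lit 1) (reg rSum) ;;
  assign aOut (reg rTasks + reg rJ + lit 1) (reg rCount) ;;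
  setReg rSum (reg rSum + reg rCount)

/-- Gives consecutive intervals of robots to the tasks in the best set. -/
def answer : Prog :=
  assign aOut (lit 0) (reg rTasks + reg rTasks) ;;
  setReg rSum (lit 0) ;;
  forLoop rJ rTasks answerLoop

/-- The approximation scheme. -/
def scheme : Prog := prepare ;; enumerate ;; fillTable ;; scanTable ;; answer

@[simp] theorem eval_add (σ : Memory) (e f : Expr) : (e + f).eval σ = e.eval σ + f.eval σ := rfl
@[simp] theorem eval_sub (σ : Memory) (e f : Expr) : (e - f).eval σ = e.eval σ - f.eval σ := rfl
@[simp] theorem eval_mul (σ : Memory) (e f : Expr) : (e * f).eval σ = e.eval σ * f.eval σ := rfl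
@[simp] theorem eval_div (σ : Memory) (e f : Expr) : (e / f).eval σ = e.eval σ / f.eval σ := rfl
@[simp] theorem eval_lit (σ : Memory) (a : ℕ) : (lit a).eval σ = a := rfl
@[simp] theorem eval_get (σ : Memory) (x : ℕ) (i : Expr) :
    (get x i).eval σ = σ x (i.eval σ) := rfl

end Program

end RAM

/-! ### Correctness of the algorithm -/

namespace TaskAllocation

namespace Data

open Finset RAM

/-- The data in the format of the input of the algorithm. -/
structure IsInput (I : Data) (a : ℕ → ℕ) : Prop where
  num : a 1 = I.num
  den : a 2 = I.den
  n : a 3 = I.n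
  m : a 4 = I.m
  W : a 5 = I.W
  q : ∀ j < I.m, a (6 + j) = I.q j
  c : ∀ j < I.m, a (6 + I.m + j) = I.c j
  d : ∀ j < I.m, a (6 + I.m + I.m + j) = I.d j

/-- Conditions on the data under which all loops of the algorithm make at most `R` rounds, and all
numbers that it stores have at most `B` bits. The denominators are positive, so that the partial
products of the denominators do not exceed the common denominator. -/
structure Bounds (I : Data) (B R : ℕ) : Prop where
  pos : ∀ j < I.m, 0 < I.d j
  rounds : R < 2 ^ B
  codes : (I.m + 2) ^ I.small ≤ R
  small : I.small ≤ R
  entries : (I.m + 1) * I.width ≤ R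
  commonDen : I.commonDen < 2 ^ B
  pow : 2 ^ I.m < 2 ^ B
  loads : ∑ j ∈ range I.m, I.q j < 2 ^ B
  prices : ∑ j ∈ range I.m, I.price j < 2 ^ B
  budget : I.budget < 2 ^ B
  masks : (I.m + 2) ^ I.small * 2 ^ I.m < 2 ^ B
  keys : ∀ j < I.m, I.key j < 2 ^ B
  values : ∑ j ∈ range I.m, I.value j + 1 < 2 ^ B

theorem Bounds.width_le {I : Data} {B R : ℕ} (h : I.Bounds B R) : I.width ≤ R :=
  le_trans (Nat.le_mul_of_pos_left _ (Nat.succ_pos _)) h.entries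

theorem lt_width (I : Data) : I.m < I.width := by
  unfold width base
  nlinarith [Nat.zero_le (I.m * I.m), Nat.zero_le (I.m * I.m * I.m)]

theorem Bounds.tasks_le {I : Data} {B R : ℕ} (h : I.Bounds B R) : I.m ≤ R :=
  I.lt_width.le.trans h.width_le

/-- The contents of the memory after `RAM.prepare`. -/
structure Prepared (I : Data) (σ : Memory) : Prop where
  input : I.IsInput (σ aIn)
  tasks : σ rTasks 0 = I.m
  mask : ∀ d, σ aMask d = digitMask I.m d
  price : ∀ j < I.m, σ aPrice j = I.price j
  budget : σ rBudget 0 = I.budget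
  pow : σ rPow 0 = 2 ^ I.m

theorem Prepared.congr {I : Data} {σ τ : Memory} (h : I.Prepared σ)
    (hτ : ∀ x ∈ [aIn, rTasks, aMask, aPrice, rBudget, rPow], τ x = σ x) : I.Prepared τ := by
  simp only [List.mem_cons, List.not_mem_nil, or_false, forall_eq_or_imp, forall_eq] at hτ
  obtain ⟨h0, h2, h4, h5, h19, h20⟩ := hτ
  exact ⟨h0 ▸ h.input, h2 ▸ h.tasks, h4 ▸ h.mask, h5 ▸ h.price, h19 ▸ h.budget, h20 ▸ h.pow⟩

theorem prepare_spec {I : Data} {B R : ℕ} (hB : I.Bounds B R) {σ : Memory}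
    (hin : I.IsInput (σ aIn)) (h4 : ∀ d, σ aMask d = 0) :
    wp B R prepare I.Prepared σ := by
  have hd : ∀ {i}, i ≤ I.m → ∏ j ∈ range i, I.d j ≤ I.commonDen := fun {i} hi =>
    prod_le_prod_of_subset_of_one_le' (range_mono hi)
      fun j hj _ => hB.pos j (mem_range.1 hj)
  have hpow : ∀ {i}, i ≤ I.m → 2 ^ i < 2 ^ B := fun {i} hi =>
    lt_of_le_of_lt (Nat.pow_le_pow_right (by norm_num) hi) hB.pow
  have hmB : I.m < 2 ^ B := hB.tasks_le.trans_lt hB.rounds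
  have h1B : 1 < 2 ^ B := lt_of_le_of_lt Nat.one_le_two_pow hB.pow
  refine wp_seq (wp_assign (by simpa [hin.m] using hmB) ?_)
  refine wp_seq (wp_assign (by simpa using h1B) ?_)
  refine wp_seq (wp_assign (by simpa using h1B) ?_)
  simp only [eval_get, eval_lit, hin.m]
  refine wp_seq (wp_forLoop (N := I.m) (by simp) hB.tasks_le hmB (by decide) (by decide)
    (by decide) (fun i τ => τ rDen 0 = ∏ j ∈ range i, I.d j ∧ τ rPow 0 = 2 ^ i ∧
      ∀ d, τ aMask d = digitMask i d) ?_ ?_ ?_)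
  · refine ⟨by simp, by simp, fun d => ?_⟩
    rw [digitMask, if_neg (by omega)]
    simp [h4]
  · intro i τ hi hj hfr ⟨h3, h20, hP⟩
    have h0 := hfr aIn (by decide) (by decide)
    have h2 := hfr rTasks (by decide) (by decide)
    simp at h0 h2
    have hdi : τ aIn (6 + I.m + I.m + i) = I.d i := by rw [h0, hin.d i hi]
    have hp1 := hd (i := i + 1) hi
    rw [prod_range_succ] at hp1
    refine wp_seq (wp_assign ?_ (wp_seq (wp_assign ?_ (wp_assign ?_ ?_))))
    · simpa [denExpr, h2, hj, h3, hdi] using hp1.trans_lt hB.commonDen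
    · simpa [h20] using hpow hi.le
    · simpa [h20, ← pow_succ] using hpow (i := i + 1) hi
    · simp [denExpr, h2, hj, h3, hdi, h20, prod_range_succ, pow_succ]
      intro d
      by_cases h : d = i + 1
      · subst h
        simp [digitMask]
      · rw [Function.update_of_ne h, hP]
        unfold digitMask
        congr 1
        simp only [eq_iff_iff]
        omega
  intro τ hfr ⟨h3, h20, hP⟩
  have h0 := hfr aIn (by decide) (by decide)
  have h2 := hfr rTasks (by decide) (by decide)
  simp at h0 h2
  refine wp_seq (wp_forLoop (N := I.m) (by simp [h2]) hB.tasks_le hmB (by decide) (by decide)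
    (by decide) (fun i ρ => ∀ j < i, ρ aPrice j = I.price j) (by simp) ?_ ?_)
  · intro i ρ hi hj hfr' h5
    have h0' := hfr' aIn (by decide) (by decide)
    have h2' := hfr' rTasks (by decide) (by decide)
    have h3' := hfr' rDen (by decide) (by decide)
    have hq : ρ aIn (6 + i) = I.q i := by rw [h0', h0, hin.q i hi]
    have hc : ρ aIn (6 + I.m + i) = I.c i := by rw [h0', h0, hin.c i hi]
    have hdi : ρ aIn (6 + I.m + I.m + i) = I.d i := by rw [h0', h0, hin.d i hi]
    have hval : (reqExpr (reg rJ) |>.mul (numExpr (reg rJ)) |>.mul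
        ((reg rDen).div (denExpr (reg rJ)))).eval ρ = I.price i := by
      simp [Expr.eval, reqExpr, numExpr, denExpr, h2', h2, hj, h3', h3, hq, hc, hdi, Data.price,
        Data.commonDen]
    refine wp_assign (e := (reqExpr (reg rJ) |>.mul (numExpr (reg rJ)) |>.mul
        ((reg rDen).div (denExpr (reg rJ))))) ?_ ?_
    · rw [hval]
      exact (single_le_sum (f := I.price) (fun _ _ => Nat.zero_le _) (mem_range.2 hi)).trans_lt
        hB.prices
    · rw [hval]
      simp [hj]
      intro j hji
      by_cases h : j = i
      · subst h
        simp
      · rw [Function.update_of_ne h, h5 j (by omega)]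
  intro ρ hfr' h5
  have h0' := hfr' aIn (by decide) (by decide)
  have h2' := hfr' rTasks (by decide) (by decide)
  have h3' := hfr' rDen (by decide) (by decide)
  have h4' := hfr' aMask (by decide) (by decide)
  have h20' := hfr' rPow (by decide) (by decide)
  have hval : ρ aIn 5 * ρ rDen 0 = I.budget := by
    rw [h0', h0, hin.W, h3', h3, Data.budget, Data.commonDen]
  refine wp_assign (by simpa [hval] using hB.budget) ?_
  constructor
  · simpa [h0', h0] using hin
  · simp [h2', h2]
  · simpa [h4'] using hP
  · simpa using h5
  · simp [hval]
  · simp [h20', h20]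

theorem bitExpr_eval {I : Data} {σ : Memory} (h : ∀ d, σ aMask d = digitMask I.m d) (x j : Expr)
    (hj : j.eval σ < I.m) : (bitExpr x j).eval σ = bit (x.eval σ) (j.eval σ) := by
  have h1 : digitMask I.m (j.eval σ + 1) = 2 ^ j.eval σ := by
    rw [digitMask, if_pos (by omega), Nat.add_sub_cancel]
  simp only [bitExpr, eval_sub, eval_div, eval_mul, eval_get, eval_add, eval_lit, h, h1, bit]
  omega

theorem count_le (I : Data) (x : ℕ) : I.count x ≤ I.m := by
  simpa [count] using sum_le_card_nsmul (range I.m) (bit x) 1 fun j _ => bit_le_one x j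

theorem sum_bit_mul_le {I : Data} (x : ℕ) (f : ℕ → ℕ) {i : ℕ} (hi : i ≤ I.m) :
    ∑ j ∈ range i, bit x j * f j ≤ ∑ j ∈ range I.m, f j :=
  (sum_le_sum fun j _ => (Nat.mul_le_mul_right _ (bit_le_one x j)).trans (one_mul _).le).trans
    (sum_le_sum_of_subset (range_mono hi))

/-- The stored set is feasible, its size is stored, and it is largest among the feasible sets that
are represented by numbers with property `C`. -/
structure Best (I : Data) (C : ℕ → Prop) (σ : Memory) : Prop where
  feasible : I.Feasible (σ rBestX 0)
  count : σ rBest 0 = I.count (σ rBestX 0)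
  max : ∀ x, C x → I.Feasible x → I.count x ≤ σ rBest 0

theorem Best.congr {I : Data} {C : ℕ → Prop} {σ τ : Memory} (h : I.Best C σ)
    (h15 : τ rBest = σ rBest) (h16 : τ rBestX = σ rBestX) : I.Best C τ :=
  ⟨h16 ▸ h.feasible, h15 ▸ h16 ▸ h.count, h15 ▸ h.max⟩

theorem Best.mono {I : Data} {C C' : ℕ → Prop} {σ : Memory} (h : I.Best C σ)
    (hC : ∀ x, C' x → C x) : I.Best C' σ :=
  ⟨h.feasible, h.count, fun x hx => h.max x (hC x hx)⟩

/-- The number in `rX` is added to those among which the stored set is best. -/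
theorem check_spec {I : Data} {B R : ℕ} (hB : I.Bounds B R) {C : ℕ → Prop} {σ : Memory}
    (hP : I.Prepared σ) (hC : I.Best C σ) :
    wp B R check (I.Best fun x => x = σ rX 0 ∨ C x) σ := by
  refine wp_of_fits fun hσ => ?_
  have hmB : I.m < 2 ^ B := hB.tasks_le.trans_lt hB.rounds
  have h0B : 0 < 2 ^ B := by positivity
  refine wp_seq (wp_assign (by simp) ?_)
  refine wp_seq (wp_assign (by simp) ?_)
  refine wp_seq (wp_assign (by simp) ?_)
  refine wp_seq (wp_forLoop (N := I.m) (by simp [hP.tasks]) hB.tasks_le hmB (by decide) (by decide)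
    (by decide) (fun i τ => τ rCount 0 = ∑ j ∈ range i, bit (σ rX 0) j ∧
      τ rLoad 0 = ∑ j ∈ range i, bit (σ rX 0) j * I.q j ∧
      τ rCost 0 = ∑ j ∈ range i, bit (σ rX 0) j * I.price j) (by simp) ?_ ?_)
  · intro i τ hi hj hfr ⟨h12, h13, h14⟩
    have hPτ : I.Prepared τ := hP.congr fun x hx => by
      rw [hfr x (by revert x; decide) (by revert x; decide)]
      rw [Memory.write_of_ne, Memory.write_of_ne, Memory.write_of_ne] <;> (revert x; decide)
    have h11 := hfr rX (by decide) (by decide)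
    simp at h11
    have hbit : ∀ ρ : Memory, ρ aMask = τ aMask → ρ rJ = τ rJ → ρ rX = τ rX →
        (bitExpr (reg rX) (reg rJ)).eval ρ = bit (σ rX 0) i := fun ρ h4 h6 h11' => by
      rw [bitExpr_eval (I := I) (by rw [h4]; exact hPτ.mask) _ _ (by simp [h6, hj, hi])]
      simp [h6, hj, h11', h11]
    have e12 := sum_range_succ (bit (σ rX 0)) i
    have e13 := sum_range_succ (fun j => bit (σ rX 0) j * I.q j) i
    have e14 := sum_range_succ (fun j => bit (σ rX 0) j * I.price j) i
    have b12 := sum_bit_mul_le (I := I) (σ rX 0) (fun _ => 1) (i := i + 1) hi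
    have b13 := sum_bit_mul_le (I := I) (σ rX 0) I.q (i := i + 1) hi
    have b14 := sum_bit_mul_le (I := I) (σ rX 0) I.price (i := i + 1) hi
    have bq := hB.loads
    have bp := hB.prices
    simp at b12
    have hq : τ aIn (6 + i) = I.q i := hPτ.input.q i hi
    have hp : τ aPrice i = I.price i := hPτ.price i hi
    refine wp_seq (wp_assign ?_ (wp_seq (wp_assign ?_ (wp_assign ?_ ?_))))
    · rw [eval_add, hbit _ rfl rfl rfl]
      simp only [eval_get, eval_lit, h12]
      omega
    · rw [eval_add, eval_mul, hbit _ (by simp) (by simp) (by simp)]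
      simp [reqExpr, h13, hj, hq]
      omega
    · rw [eval_add, eval_mul, hbit _ (by simp) (by simp) (by simp)]
      simp [h14, hj, hp]
      omega
    · simp [hbit, reqExpr, h12, h13, h14, hj, hq, hp, e12, e13, e14]
  intro τ hfr ⟨h12, h13, h14⟩
  have h0 := hfr aIn (by decide) (by decide)
  have h11 := hfr rX (by decide) (by decide)
  have h15 := hfr rBest (by decide) (by decide)
  have h16 := hfr rBestX (by decide) (by decide)
  have h19 := hfr rBudget (by decide) (by decide)
  simp at h0 h11 h15 h16 h19
  change τ rCount 0 = I.count (σ rX 0) at h12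
  change τ rLoad 0 = I.load (σ rX 0) at h13
  change τ rCost 0 = I.cost (σ rX 0) at h14
  refine wp_ite (fun h => ?_) (fun h => wp_skip ?_)
  · simp [h0, h12, h13, h14, h15, h19, hP.input.n, hP.budget, Nat.sub_eq_zero_iff_le] at h
    have hle : I.count (σ rX 0) < 2 ^ B := (I.count_le _).trans_lt hmB
    refine wp_seq (wp_assign (by simpa [h12] using hle)
      (wp_assign (by simpa [h11] using hσ rX 0) ?_))
    constructor
    · simp [h11, Feasible]
      omega
    · simp [h11, h12]
    · rintro x (rfl | hx) hxf
      · simp [h12]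
      · have := hC.max x hx hxf
        simp [h12]
        omega
  · simp [h0, h12, h13, h14, h15, h19, hP.input.n, hP.budget, Nat.sub_eq_zero_iff_le] at h
    constructor
    · rw [h16]
      exact hC.feasible
    · rw [h16, h15, hC.count]
    · rw [h15]
      rintro x (rfl | hx) hxf
      · have h1 := hxf.1
        have h2 := hxf.2
        omega
      · exact hC.max x hx hxf

theorem enumerate_spec {I : Data} {B R : ℕ} (hB : I.Bounds B R) {σ : Memory}
    (hP : I.Prepared σ) (hC : I.Best (fun _ => False) σ) (h10 : σ aList 0 = 0) :
    wp B R enumerate (fun τ => I.Prepared τ ∧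
      I.Best (fun x => ∃ i < (I.m + 2) ^ I.small, x = digitsMask I.m i) τ) σ := by
  have hsB : I.small < 2 ^ B := hB.small.trans_lt hB.rounds
  have hcB : (I.m + 2) ^ I.small < 2 ^ B := hB.codes.trans_lt hB.rounds
  have h1B : 1 < 2 ^ B := lt_of_le_of_lt Nat.one_le_two_pow hB.pow
  have hsmall : σ aIn 2 / σ aIn 1 + 1 = I.small := by rw [hP.input.num, hP.input.den, Data.small]
  refine wp_seq (wp_assign (by simpa [hsmall] using hsB) ?_)
  refine wp_seq (wp_assign (by simpa using h1B) ?_)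
  simp only [eval_get, eval_lit, eval_add, eval_div, hsmall]
  refine wp_seq (wp_forLoop (N := I.small) (by simp) hB.small hsB (by decide) (by decide)
    (by decide) (fun i τ => τ rCodes 0 = (I.m + 2) ^ i) (by simp) ?_ ?_)
  · intro i τ hi hj hfr h9
    have h2 := hfr rTasks (by decide) (by decide)
    simp at h2
    have hle : (I.m + 2) ^ (i + 1) < 2 ^ B :=
      lt_of_le_of_lt (Nat.pow_le_pow_right (by omega) hi) hcB
    refine wp_assign ?_ ?_
    · simpa [h9, h2, hP.tasks, ← pow_succ] using hle
    · simp [h9, h2, hP.tasks, ← pow_succ]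
  intro τ hfr h9
  have hPτ : I.Prepared τ := hP.congr fun x hx => by
    rw [hfr x (by revert x; decide) (by revert x; decide)]
    rw [Memory.write_of_ne, Memory.write_of_ne] <;> (revert x; decide)
  have hCτ : I.Best (fun _ => False) τ := hC.congr
    (by rw [hfr rBest (by decide) (by decide)]; simp)
    (by rw [hfr rBestX (by decide) (by decide)]; simp)
  have h10' := hfr aList (by decide) (by decide)
  simp at h10'
  refine wp_forLoop (N := (I.m + 2) ^ I.small) h9 hB.codes hcB (by decide) (by decide) (by decide)
    (fun i ρ => (∀ k < i, ρ aList k = digitsMask I.m k) ∧ ρ aList 0 = 0 ∧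
      I.Best (fun x => ∃ k < i, x = digitsMask I.m k) ρ) ?_ ?_ ?_
  · refine ⟨by simp, by simp [h10', h10], (hCτ.congr (by simp) (by simp)).mono (by simp)⟩
  · intro i ρ hi hj hfr' ⟨hL, hL0, hCρ⟩
    have hPρ : I.Prepared ρ := hPτ.congr fun x hx =>
      hfr' x (by revert x; decide) (by revert x; decide)
    have hlist : ρ aList (i / (I.m + 2)) = digitsMask I.m (i / (I.m + 2)) := by
      rcases Nat.eq_zero_or_pos i with rfl | hi0
      · simp [hL0, digitsMask_zero]
      · exact hL _ (Nat.div_lt_self hi0 (by omega))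
    have hmod : i - i / (I.m + 2) * (I.m + 2) = i % (I.m + 2) := by
      rw [Nat.mod_eq_sub, mul_comm]
    have hval : ρ aList (i / (I.m + 2)) + ρ aMask (i - i / (I.m + 2) * (I.m + 2)) =
        digitsMask I.m i := by
      rw [hlist, hmod, hPρ.mask, ← digitsMask_eq]
    have hle : digitsMask I.m i < 2 ^ B := (digitsMask_le _ _).trans_lt
      (lt_of_le_of_lt (Nat.mul_le_mul_right _ hi.le) hB.masks)
    refine wp_seq (wp_assign (by simpa [hj, hPρ.tasks, hval] using hle) ?_)
    refine wp_seq (wp_assign (by simpa [hj, hPρ.tasks, hval] using hle) ?_)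
    simp only [eval_get, eval_lit, eval_add, eval_div, eval_mul, eval_sub, hj, hPρ.tasks, hval]
    refine wp.mono (check_spec hB (C := fun x => ∃ k < i, x = digitsMask I.m k)
      (hPρ.congr fun x hx => ?_) (hCρ.congr (by simp) (by simp))) ?_
    · rw [Memory.write_of_ne, Memory.write_of_ne] <;> (revert x; decide)
    · intro π hπ hCπ
      have hπ10 := hπ aList (by decide)
      simp [hj] at hπ10
      refine ⟨fun k hk => ?_, ?_, (hCπ.congr (by simp) (by simp)).mono ?_⟩
      · simp only [ne_eq, Nat.reduceEqDiff, not_false_eq_true, Memory.write_of_ne, hπ10]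
        by_cases h : k = i
        · subst h
          simp
        · rw [Function.update_of_ne h, hL k (by omega)]
      · simp only [ne_eq, Nat.reduceEqDiff, not_false_eq_true, Memory.write_of_ne, hπ10]
        by_cases h : 0 = i
        · subst h
          simp [digitsMask_zero]
        · rw [Function.update_of_ne h, hL0]
      · rintro x ⟨k, hk, rfl⟩
        by_cases h : k = i
        · left
          simp [h, hj]
        · exact Or.inr ⟨k, by omega, rfl⟩
  · intro ρ hfr' ⟨_, _, hCρ⟩
    exact ⟨hPτ.congr fun x hx => hfr' x (by revert x; decide) (by revert x; decide), hCρ⟩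

theorem fillTable_spec {I : Data} {B R : ℕ} (hB : I.Bounds B R) {σ : Memory}
    (hP : I.Prepared σ) (h18 : ∀ k, σ aTable k = 0) :
    wp B R fillTable (fun τ => τ rWidth 0 = I.width ∧ τ rEnd 0 = I.m * I.width ∧
      ∀ k < I.width, τ aTable (I.m * I.width + k) = I.table I.m k) σ := by
  have h1B : 1 < 2 ^ B := lt_of_le_of_lt Nat.one_le_two_pow hB.pow
  have hmw : I.width + I.m * I.width ≤ R := by
    have := hB.entries
    rwa [add_mul, one_mul, add_comm] at this
  have hR := hB.rounds
  have hw : I.width = (I.m + 1) * ((I.m + 1) * (I.m + 1) * (I.m + 1)) := rfl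
  have hw0 : 0 < I.width := (Nat.zero_le _).trans_lt I.lt_width
  refine wp_seq (wp_assign (by simp [hP.tasks, ← hw]; omega) ?_)
  simp only [eval_get, eval_lit, eval_add, eval_mul, hP.tasks, ← hw]
  refine wp_seq (wp_assign (by simp [hP.tasks]; omega) ?_)
  simp only [eval_get, eval_lit, eval_mul, ne_eq, Nat.reduceEqDiff, not_false_eq_true,
    Memory.write_of_ne, Memory.write_same, Function.update_self, hP.tasks]
  refine wp_seq (wp_assign (by simpa using h1B) ?_)
  refine wp_forLoop (N := I.m * I.width) (by simp) (by omega) (by omega)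
    (by decide) (by decide) (by decide)
    (fun i τ => ∀ k < I.width + i, τ aTable k = I.table (k / I.width) (k % I.width)) ?_ ?_ ?_
  · intro k hk
    rw [add_zero] at hk
    rw [Nat.div_eq_of_lt hk, Nat.mod_eq_of_lt hk, table]
    by_cases h : k = 0
    · simp [h]
    · simp [h, h18]
  · intro i τ hi hj hfr hT
    have hPτ : I.Prepared τ := hP.congr fun x hx => by
      rw [hfr x (by revert x; decide) (by revert x; decide)]
      rw [Memory.write_of_ne, Memory.write_of_ne, Memory.write_of_ne] <;> (revert x; decide)
    have h17 : τ rWidth 0 = I.width := by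
      rw [hfr rWidth (by decide) (by decide)]
      simp
    -- The entry with number `i` is the one with key `k` in row `r`.
    obtain ⟨r, hr⟩ : ∃ r, i / I.width = r := ⟨_, rfl⟩
    obtain ⟨k, hk⟩ : ∃ k, i % I.width = k := ⟨_, rfl⟩
    have hrm : r < I.m := hr ▸ Nat.div_lt_of_lt_mul (by rwa [mul_comm] at hi)
    have hkw : k < I.width := hk ▸ Nat.mod_lt _ hw0
    have hirk : i = r * I.width + k := by
      rw [mul_comm, ← hr, ← hk]
      exact (Nat.div_add_mod i I.width).symm
    have hik : i - r * I.width = k := by omega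
    have hq : τ aIn (6 + r) = I.q r := hPτ.input.q r hrm
    have hshift : (I.m + 1) * (I.m + 1) * (I.m + 1) +
        (I.q r * (I.m * I.m) / (I.n + 1) + 1) = I.key r := rfl
    have hread : ∀ k' < I.width, ∀ r', r' * I.width + k' < I.width + i →
        τ aTable (r' * I.width + k') = I.table r' k' := fun k' hk' r' h => by
      rw [hT _ h, mul_comm, Nat.mul_add_div hw0, Nat.mul_add_mod, Nat.div_eq_of_lt hk',
        Nat.mod_eq_of_lt hk', add_zero]
    have hTi : τ aTable i = I.table r k := by rw [hT i (by omega), hr, hk]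
    -- For `key r ≤ k`, the entry with number `i - key r` is in the same row.
    have hdec : (k + 1 - I.key r) * (I.n + 1 - I.q r) * τ aTable (i - I.key r) ≠ 0 ↔
        I.key r ≤ k ∧ I.q r ≤ I.n ∧ I.table r (k - I.key r) ≠ 0 := by
      by_cases h : I.key r ≤ k
      · have : i - I.key r = r * I.width + (k - I.key r) := by omega
        rw [this, hread _ (by omega) _ (by omega)]
        simp only [ne_eq, mul_eq_zero, not_or]
        constructor <;> rintro ⟨⟩ <;> refine ⟨?_, ?_⟩ <;> omega
      · have : k + 1 - I.key r = 0 := by omega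
        simp [this, h]
    have hnew : I.key r ≤ k → τ aTable (i - I.key r) = I.table r (k - I.key r) := fun h => by
      have : i - I.key r = r * I.width + (k - I.key r) := by omega
      rw [this, hread _ (by omega) _ (by omega)]
    have hmask : τ aMask (r + 1) = 2 ^ r := by
      rw [hPτ.mask, digitMask, if_pos (by omega), Nat.add_sub_cancel]
    have hrow : I.table r k < 2 ^ B := (I.table_le_sum hrm.le k).trans_lt hB.values
    -- It remains to store the right number in the new cell.
    have hpost : ∀ ρ : Memory,
        ρ aTable = Function.update (τ aTable) (I.width + i) (I.table (r + 1) k) →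
        ∀ k' < I.width + (i + 1), ρ aTable k' = I.table (k' / I.width) (k' % I.width) :=
        fun ρ hρ k' hk' => by
      rw [hρ]
      by_cases h : k' = I.width + i
      · subst h
        rw [Function.update_self, Nat.add_div_left _ hw0, Nat.add_mod_left, hr, hk]
      · rw [Function.update_of_ne h, hT k' (by omega)]
    refine wp_seq (wp_assign (by simpa [hj, h17, hr] using hrm.trans (hB.tasks_le.trans_lt hR)) ?_)
    simp only [eval_get, eval_lit, eval_div, hj, h17, hr]
    refine wp_seq (wp_assign (by simpa [hj, h17, hik] using hkw.trans (hB.width_le.trans_lt hR)) ?_)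
    simp only [eval_get, eval_lit, eval_sub, eval_mul, ne_eq, Nat.reduceEqDiff, not_false_eq_true,
      Memory.write_of_ne, Memory.write_same, Function.update_self, hj, h17, hik]
    refine wp_seq (wp_assign ?_ ?_)
    · simpa [reqExpr, hPτ.tasks, hq, hPτ.input.n, hshift] using hB.keys r hrm
    simp only [eval_get, eval_lit, eval_add, eval_mul, eval_div, reqExpr, ne_eq, Nat.reduceEqDiff,
      OfNat.zero_ne_ofNat, not_false_eq_true, Memory.write_of_ne, Memory.write_same,
      Function.update_self, hPτ.tasks, hq, hPτ.input.n, hshift]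
    refine wp_seq (wp_assign (by simpa [hj, hTi] using hrow) ?_)
    simp only [eval_get, eval_lit, eval_add, ne_eq, Nat.reduceEqDiff, not_false_eq_true,
      Memory.write_of_ne, hj, h17, hTi]
    have hext : I.table (r + 1) k = better (I.table r k) (I.extend (I.table r) r k) := rfl
    generalize hρ : Memory.write _ aTable (I.width + i) (I.table r k) = ρ
    have a18 : ρ aTable = Function.update (τ aTable) (I.width + i) (I.table r k) := by simp [← hρ]
    have a0 : ρ aIn = τ aIn := by simp [← hρ]
    have a4 : ρ aMask (r + 1) = 2 ^ r := by simp [← hρ, hmask]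
    have a5 : ρ aPrice r = I.price r := by simp [← hρ, hPτ.price r hrm]
    have a7 : ρ rI 0 = i := by simp [← hρ, hj]
    have a17 : ρ rWidth 0 = I.width := by simp [← hρ, h17]
    have a20 : ρ rPow 0 = 2 ^ I.m := by simp [← hρ, hPτ.pow]
    have a21 : ρ rRow 0 = r := by simp [← hρ]
    have a22 : ρ rKey 0 = k := by simp [← hρ]
    have a23 : ρ rShift 0 = I.key r := by simp [← hρ]
    have aold : ρ aTable (i - I.key r) = τ aTable (i - I.key r) := by
      rw [a18, Function.update_of_ne (by omega)]
    have acur : ρ aTable i = I.table r k := by rw [a18, Function.update_of_ne (by omega), hTi]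
    refine wp_ite (fun h => ?_) (fun h => wp_skip (hpost _ ?_))
    · simp only [eval_get, eval_lit, eval_add, eval_sub, eval_mul, a0, a7, a21, a22, a23,
        aold, hq, hPτ.input.n] at h
      have h' := hdec.1 h
      have hextend : I.extend (I.table r) r k = I.table r (k - I.key r) + I.value r := by
        rw [extend, if_pos h']
      have hval : τ aTable (i - I.key r) + (I.price r * 2 ^ I.m + 2 ^ r) =
          I.extend (I.table r) r k := by
        rw [hextend, hnew h'.1, value]
      -- The new entry is stored even if it is not the better one, so that it has to fit as well.
      have hextlt : I.extend (I.table r) r k < 2 ^ B := by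
        obtain ⟨S, hS, -, -, hST⟩ := I.exists_of_table_ne_zero r _ h'.2.2
        have hrS : r ∉ S := fun h => by simpa using hS h
        have hsub : insert r S ⊆ range I.m :=
          insert_subset (mem_range.2 hrm) (hS.trans (range_mono hrm.le))
        have := sum_le_sum_of_subset (f := I.value) hsub
        rw [sum_insert hrS] at this
        have := hB.values
        rw [hextend, hST]
        omega
      have hpos : I.extend (I.table r) r k ≠ 0 := by
        have := h'.2.2
        omega
      refine wp_seq (wp_assign ?_ ?_)
      · simpa only [eval_get, eval_lit, eval_add, eval_sub, eval_mul, a4, a5, a7, a20, a21, a23,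
          aold, hval] using hextlt
      simp only [eval_get, eval_lit, eval_add, eval_sub, eval_mul, a4, a5, a7, a20, a21, a23,
        aold, hval]
      refine wp_ite (fun h => ?_) (fun h => wp_skip (hpost _ ?_))
      · simp [a7, acur] at h
        have hb : I.table (r + 1) k = I.extend (I.table r) r k := by
          rw [hext, better, if_pos ⟨hpos, by omega⟩]
        refine wp_assign (by simpa using hextlt) (hpost _ ?_)
        simp [a7, a17, a18, hb]
      · simp [a7, acur] at h
        have hb : I.table (r + 1) k = I.table r k := by
          rw [hext, better, if_neg (by omega)]
        simp [a18, hb]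
    · simp only [eval_get, eval_lit, eval_add, eval_sub, eval_mul, a0, a7, a21, a22, a23,
        aold, hq, hPτ.input.n] at h
      have hb : I.table (r + 1) k = I.table r k := by
        rw [hext, extend, if_neg fun h' => hdec.2 h' h]
        simp [better]
      rw [a18, hb]
  · intro τ hfr hT
    refine ⟨by rw [hfr rWidth (by decide) (by decide)]; simp,
      by rw [hfr rEnd (by decide) (by decide)]; simp, fun k hk => ?_⟩
    rw [hT _ (by omega), mul_comm, Nat.mul_add_div hw0, Nat.mul_add_mod, Nat.div_eq_of_lt hk,
      Nat.mod_eq_of_lt hk, add_zero]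

theorem scanTable_spec {I : Data} {B R : ℕ} (hB : I.Bounds B R) {C : ℕ → Prop} {σ : Memory}
    (hP : I.Prepared σ) (hC : I.Best C σ) (h17 : σ rWidth 0 = I.width)
    (h24 : σ rEnd 0 = I.m * I.width)
    (h18 : ∀ k < I.width, σ aTable (I.m * I.width + k) = I.table I.m k) :
    wp B R scanTable (I.Best fun x => C x ∨ ∃ k < I.width, x = I.table I.m k - 1) σ := by
  refine wp_forLoop (N := I.width) h17 hB.width_le (hB.width_le.trans_lt hB.rounds) (by decide)
    (by decide) (by decide) (fun i => I.Best fun x => C x ∨ ∃ k < i, x = I.table I.m k - 1)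
    ?_ ?_ (fun τ _ h => h)
  · exact (hC.congr (by simp) (by simp)).mono (by simp)
  · intro i τ hi hj hfr hCτ
    have hPτ : I.Prepared τ := hP.congr fun x hx =>
      hfr x (by revert x; decide) (by revert x; decide)
    have h18' := hfr aTable (by decide) (by decide)
    have h24' := hfr rEnd (by decide) (by decide)
    have hlt : I.table I.m i - 1 < 2 ^ B :=
      (Nat.sub_le _ _).trans_lt ((I.table_le_sum le_rfl i).trans_lt hB.values)
    refine wp_seq (wp_assign (by simpa [h24', h24, hj, h18', h18 i hi] using hlt) ?_)
    simp only [eval_get, eval_lit, eval_add, eval_sub, h24', h24, hj, h18', h18 i hi]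
    refine wp.mono (check_spec hB (hPτ.congr fun x hx => ?_)
      (hCτ.congr (by simp) (by simp))) ?_
    · rw [Memory.write_of_ne]
      revert x
      decide
    · intro ρ _ hCρ
      refine (hCρ.congr (by simp) (by simp)).mono ?_
      rintro x (hx | ⟨k, hk, rfl⟩)
      · exact Or.inr (Or.inl hx)
      · by_cases h : k = i
        · left
          simp [h]
        · exact Or.inr (Or.inr ⟨k, by omega, rfl⟩)

/-- The number of robots that are given to task `j` if the set represented by `x` is handled. -/
def share (I : Data) (x j : ℕ) : ℕ := bit x j * I.q j

/-- The first robot that is given to task `j`. -/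
def start (I : Data) (x j : ℕ) : ℕ := ∑ i ∈ range j, I.share x i

theorem start_succ (I : Data) (x j : ℕ) : I.start x (j + 1) = I.start x j + I.share x j :=
  sum_range_succ _ _

theorem answer_spec {I : Data} {B R : ℕ} (hB : I.Bounds B R) {σ : Memory} (hP : I.Prepared σ) :
    wp B R answer (fun τ => τ aOut 0 = I.m + I.m ∧
      (∀ j < I.m, τ aOut (j + 1) = I.start (σ rBestX 0) j) ∧
      ∀ j < I.m, τ aOut (I.m + j + 1) = I.share (σ rBestX 0) j) σ := by
  have hmB : I.m < 2 ^ B := hB.tasks_le.trans_lt hB.rounds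
  have h2m : I.m + I.m < 2 ^ B := by
    refine lt_of_le_of_lt ?_ (hB.width_le.trans_lt hB.rounds)
    unfold width base
    nlinarith [Nat.zero_le (I.m * I.m), Nat.zero_le (I.m * I.m * I.m)]
  refine wp_seq (wp_assign (by simpa [hP.tasks] using h2m) ?_)
  refine wp_seq (wp_assign (by simp) ?_)
  simp only [eval_get, eval_lit, eval_add, hP.tasks]
  refine wp_forLoop (N := I.m) (by simp [hP.tasks]) hB.tasks_le hmB (by decide) (by decide)
    (by decide) (fun i τ => τ rSum 0 = I.start (σ rBestX 0) i ∧ τ aOut 0 = I.m + I.m ∧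
      (∀ j < i, τ aOut (j + 1) = I.start (σ rBestX 0) j) ∧
      ∀ j < i, τ aOut (I.m + j + 1) = I.share (σ rBestX 0) j) ?_ ?_ (fun τ _ h => h.2)
  · simp [start]
  · intro i τ hi hj hfr ⟨h26, h10, h11, h12⟩
    have hPτ : I.Prepared τ := hP.congr fun x hx => by
      rw [hfr x (by revert x; decide) (by revert x; decide)]
      rw [Memory.write_of_ne, Memory.write_of_ne] <;> (revert x; decide)
    have h16 := hfr rBestX (by decide) (by decide)
    simp at h16
    have hbit : (bitExpr (reg rBestX) (reg rJ)).eval τ = bit (σ rBestX 0) i := by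
      rw [bitExpr_eval hPτ.mask _ _ (by simp [hj, hi])]
      simp [h16, hj]
    have hq : τ aIn (6 + i) = I.q i := hPτ.input.q i hi
    have hshare : bit (σ rBestX 0) i * I.q i = I.share (σ rBestX 0) i := rfl
    have hstart : I.start (σ rBestX 0) (i + 1) < 2 ^ B :=
      (sum_bit_mul_le (I := I) (σ rBestX 0) I.q hi).trans_lt hB.loads
    rw [start_succ] at hstart
    refine wp_seq (wp_assign ?_ ?_)
    · rw [eval_mul, hbit]
      simp [reqExpr, hj, hq, hshare]
      omega
    rw [eval_mul, hbit]
    simp only [reqExpr, eval_get, eval_add, eval_lit, hj, hq, hshare]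
    refine wp_seq (wp_assign (by simp [h26]; omega) (wp_seq (wp_assign (by simp; omega)
      (wp_assign (by simp [h26]; omega) ?_))))
    simp only [eval_get, eval_add, eval_lit, ne_eq, Nat.reduceEqDiff, OfNat.one_ne_ofNat,
      OfNat.ofNat_ne_one, not_false_eq_true, Memory.write_of_ne, Memory.write_same,
      Function.update_self, hj, h26, hPτ.tasks]
    refine ⟨(I.start_succ _ _).symm, ?_, fun j hji => ?_, fun j hji => ?_⟩
    · rw [Function.update_of_ne (by omega), Function.update_of_ne (by omega), h10]
    · rw [Function.update_of_ne (by omega)]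
      by_cases h : j = i
      · subst h
        rw [Function.update_self]
      · rw [Function.update_of_ne (by omega), h11 j (by omega)]
    · by_cases h : j = i
      · subst h
        rw [Function.update_self]
      · rw [Function.update_of_ne (by omega), Function.update_of_ne (by omega), h12 j (by omega)]

/-- The algorithm finds an optimal set of tasks if the optimum is small, and misses the optimum by
at most one task otherwise. -/
theorem scheme_spec {I : Data} {B R : ℕ} (hB : I.Bounds B R) {σ : Memory}
    (hin : I.IsInput (σ aIn)) (h0 : ∀ x, x ≠ 0 → ∀ k, σ x k = 0) :
    wp B R scheme (fun τ => ∃ x, I.Feasible x ∧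
      (∀ S ⊆ range I.m, ∑ j ∈ S, I.q j ≤ I.n → ∑ j ∈ S, I.price j ≤ I.budget →
        (#S ≤ I.small → #S ≤ I.count x) ∧ #S ≤ I.count x + 1) ∧
      output τ = (List.range I.m).map (I.start x) ++ (List.range I.m).map (I.share x)) σ := by
  refine wp_seq (wp.mono (prepare_spec hB hin (h0 aMask (by decide))) fun τ₁ f₁ P₁ => ?_)
  have best₁ : I.Best (fun _ => False) τ₁ := by
    have h15 := f₁ rBest (by decide)
    have h16 := f₁ rBestX (by decide)
    constructor
    · simp [h16, h0, Feasible, load, Data.cost, bit]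
    · simp [h15, h16, h0, Data.count, bit]
    · simp
  refine wp_seq (wp.mono (enumerate_spec hB P₁ best₁ ?_) fun τ₂ f₂ ⟨P₂, best₂⟩ => ?_)
  · rw [f₁ aList (by decide), h0 aList (by decide)]
  refine wp_seq (wp.mono (fillTable_spec hB P₂ ?_) fun τ₃ f₃ ⟨h17, h24, h18⟩ => ?_)
  · intro k
    rw [f₂ aTable (by decide), f₁ aTable (by decide), h0 aTable (by decide)]
  have P₃ : I.Prepared τ₃ := P₂.congr fun x hx => f₃ x (by revert x; decide)
  have best₃ := best₂.congr (f₃ rBest (by decide)) (f₃ rBestX (by decide))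
  refine wp_seq (wp.mono (scanTable_spec hB P₃ best₃ h17 h24 h18) fun τ₄ f₄ best₄ => ?_)
  have P₄ : I.Prepared τ₄ := P₃.congr fun x hx => f₄ x (by revert x; decide)
  refine wp.mono (answer_spec hB P₄) fun τ₅ _ ⟨hlen, hs, hk⟩ => ?_
  refine ⟨τ₄ rBestX 0, best₄.feasible, fun S hS hq hp => ⟨fun hcard => ?_, ?_⟩, ?_⟩
  · obtain ⟨i, hi, hif, hic⟩ := I.exists_digits hS hq hp hcard
    have := best₄.max _ (Or.inl ⟨i, hi, rfl⟩) hif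
    rw [← best₄.count]
    omega
  · rcases S.eq_empty_or_nonempty with rfl | hne
    · simp
    · obtain ⟨k, hk, hkf, hkc⟩ := I.exists_table_entry hS hq hp hne
      have := best₄.max _ (Or.inr ⟨k, hk, rfl⟩) hkf
      rw [← best₄.count]
      omega
  · rw [output, hlen, List.range_add, List.map_append, List.map_map]
    congr 1
    · exact List.map_congr_left fun j hj => hs j (List.mem_range.1 hj)
    · exact List.map_congr_left fun j hj => hk j (List.mem_range.1 hj)

end Data

/-! ### The robots of an allocation -/

open Finset RAM

namespace Problem

variable (P : Problem)

theorem mem_robotsOf {A : P.Allocation} {i : Fin P.n} {j : Fin P.m} :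
    i ∈ P.robotsOf A j ↔ A i = some j := by
  simp [robotsOf]

theorem mem_handled {A : P.Allocation} {j : Fin P.m} :
    j ∈ P.handled A ↔ P.q j ≤ #(P.robotsOf A j) := by
  simp [handled]

theorem sum_card_robotsOf_le (A : P.Allocation) : ∑ j, #(P.robotsOf A j) ≤ P.n := by
  calc ∑ j, #(P.robotsOf A j) = ∑ j, ∑ i, if A i = some j then 1 else 0 :=
        sum_congr rfl fun j _ => by rw [robotsOf, card_filter]
    _ = ∑ i, ∑ j, if A i = some j then 1 else 0 := sum_comm
    _ ≤ ∑ i : Fin P.n, 1 := by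
        refine sum_le_sum fun i _ => ?_
        cases h : A i with
        | none => simp
        | some k =>
          simp only [Option.some.injEq]
          rw [sum_ite_eq]
          simp
    _ = P.n := by simp

end Problem

/-! ### The length of the input -/

theorem length_le_bitLength (l : List ℕ) : l.length ≤ bitLength l := by
  induction l with
  | nil => simp
  | cons a l ih =>
    simp only [bitLength, List.map_cons, List.sum_cons, List.length_cons] at ih ⊢
    omega

theorem le_two_pow_bitLength {l : List ℕ} {a : ℕ} (h : a ∈ l) : a ≤ 2 ^ bitLength l := by
  have h1 : Nat.size a + 1 ≤ bitLength l :=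
    List.single_le_sum (fun _ _ => Nat.zero_le _) _ (List.mem_map_of_mem h)
  exact (Nat.lt_size_self a).le.trans (Nat.pow_le_pow_right (by norm_num) (by omega))

theorem prod_le_two_pow_bitLength (l : List ℕ) : l.prod ≤ 2 ^ bitLength l := by
  induction l with
  | nil => simp [bitLength]
  | cons a l ih =>
    have h : bitLength (a :: l) = Nat.size a + 1 + bitLength l := by simp [bitLength]
    rw [List.prod_cons, h, pow_add]
    refine Nat.mul_le_mul ((Nat.lt_size_self a).le.trans ?_) ih
    exact Nat.pow_le_pow_right (by norm_num) (by omega)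

namespace SymProblem

variable (I : SymProblem)

/-- The data of an instance and of a number `a / b` in the role of `ε`. -/
abbrev toData (a b : ℕ) : Data where
  num := a
  den := b
  n := I.n
  m := I.m
  W := I.W
  q j := if h : j < I.m then I.q ⟨j, h⟩ else 0
  c j := if h : j < I.m then (I.c ⟨j, h⟩).num else 0
  d j := if h : j < I.m then (I.c ⟨j, h⟩).den else 1

@[simp] theorem toData_q (a b : ℕ) (j : Fin I.m) : (I.toData a b).q j = I.q j := by
  simp

@[simp] theorem toData_c (a b : ℕ) (j : Fin I.m) : (I.toData a b).c j = (I.c j).num := by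
  simp

@[simp] theorem toData_d (a b : ℕ) (j : Fin I.m) : (I.toData a b).d j = (I.c j).den := by
  simp

theorem isInput (a b : ℕ) :
    (I.toData a b).IsInput (input (a :: b :: I.encode) 0) := by
  have hshift : ∀ j, input (a :: b :: I.encode) 0 (6 + j) =
      (List.ofFn I.q ++ (List.ofFn (fun j => (I.c j).num) ++
        List.ofFn (fun j => (I.c j).den))).getD j 0 := fun j => by
    rw [add_comm]
    simp [input, encode]
  constructor
  · simp [input]
  · simp [input]
  · simp [input, encode]
  · simp [input, encode]
  · simp [input, encode]
  · intro j hj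
    change j < I.m at hj
    rw [hshift, List.getD_append _ _ _ _ (by simpa using hj)]
    simp [List.getD_eq_getElem?_getD, hj]
  · intro j hj
    change j < I.m at hj
    rw [add_assoc, hshift, List.getD_append_right _ _ _ _ (by simp),
      List.getD_append _ _ _ _ (by simpa using hj)]
    simp [List.getD_eq_getElem?_getD, hj]
  · intro j hj
    change j < I.m at hj
    rw [add_assoc, add_assoc, hshift, List.getD_append_right _ _ _ _ (by simp),
      List.getD_append_right _ _ _ _ (by simp)]
    simp [List.getD_eq_getElem?_getD, hj]

/-- A bound for the number of rounds of the loops, for an input of length `L`. -/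
def roundBound (s L : ℕ) : ℕ := (L + 2) ^ (s + 5)

/-- A bound for the number of bits of all numbers that occur, for an input of length `L`. -/
def bitBound (a b s L : ℕ) : ℕ := (L + 1) * (s + 7) + (a + b)

theorem tasks_le_bitLength : I.m ≤ bitLength I.encode := by
  refine le_trans ?_ (length_le_bitLength I.encode)
  simp only [encode, List.length_append, List.length_ofFn]
  omega

theorem commonDen_le (a b : ℕ) : (I.toData a b).commonDen ≤ 2 ^ bitLength I.encode := by
  have h1 : (I.toData a b).commonDen = (List.ofFn fun j => (I.c j).den).prod := by
    rw [List.prod_ofFn, Data.commonDen]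
    exact (Fin.prod_univ_eq_prod_range (I.toData a b).d I.m).symm.trans
      (prod_congr rfl fun j _ => I.toData_d a b j)
  rw [h1]
  refine (prod_le_two_pow_bitLength _).trans (Nat.pow_le_pow_right (by norm_num) ?_)
  simp [encode, bitLength]
  omega

theorem bounds (a b : ℕ) :
    (I.toData a b).Bounds (bitBound a b (I.toData a b).small (bitLength I.encode))
      (roundBound (I.toData a b).small (bitLength I.encode)) := by
  have hq : ∀ j, (I.toData a b).q j ≤ 2 ^ bitLength I.encode := fun j => by
    by_cases h : j < I.m
    · simp only [h, dif_pos]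
      exact le_two_pow_bitLength (by simp [encode])
    · simp [h]
  have hc : ∀ j, (I.toData a b).c j ≤ 2 ^ bitLength I.encode := fun j => by
    by_cases h : j < I.m
    · simp only [h, dif_pos]
      exact le_two_pow_bitLength (by simp [encode])
    · simp [h]
  have hW : (I.toData a b).W ≤ 2 ^ bitLength I.encode :=
    le_two_pow_bitLength (by simp [encode])
  have hD := I.commonDen_le a b
  have hm : (I.toData a b).m ≤ bitLength I.encode := I.tasks_le_bitLength
  have hpos : ∀ j < (I.toData a b).m, 0 < (I.toData a b).d j := fun j hj => by
    rw [I.toData_d a b ⟨j, hj⟩]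
    exact NNRat.den_pos _
  generalize bitLength I.encode = L at *
  generalize I.toData a b = J at *
  obtain ⟨s, hs⟩ : ∃ s, J.small = s := ⟨_, rfl⟩
  rw [hs]
  set A := 2 ^ L with hA
  have hL : L < A := Nat.lt_two_pow_self
  have hA1 : 1 ≤ A := Nat.one_le_two_pow
  have hmA : J.m + 1 ≤ A := by omega
  -- Every number that is at most `2 ^ e` with such an exponent fits.
  have hfit : ∀ e < (L + 1) * (s + 7), 2 ^ e < 2 ^ bitBound a b s L := fun e he =>
    Nat.pow_lt_pow_right (by norm_num) (by unfold bitBound; omega)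
  have hfit' : ∀ e < (L + 1) * 7, 2 ^ e < 2 ^ bitBound a b s L := fun e he =>
    hfit e (he.trans_le (Nat.mul_le_mul_left _ (by omega)))
  have hL2 : L + 2 ≤ 2 ^ (L + 1) := by
    rw [pow_succ]
    omega
  have hprice : ∀ j, J.price j ≤ A ^ 3 := fun j => by
    calc J.price j ≤ A * A * A :=
          Nat.mul_le_mul (Nat.mul_le_mul (hq j) (hc j)) ((Nat.div_le_self _ _).trans hD)
      _ = A ^ 3 := by ring
  have hsum : ∀ (f : ℕ → ℕ) (c : ℕ), (∀ j, f j ≤ c) → ∑ j ∈ range J.m, f j ≤ A * c :=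
    fun f c hf => by
      have := sum_le_card_nsmul (range J.m) f c fun j _ => hf j
      rw [card_range, smul_eq_mul] at this
      exact this.trans (Nat.mul_le_mul_right _ (by omega))
  have hpowm : 2 ^ J.m ≤ A := Nat.pow_le_pow_right (by norm_num) hm
  have hApow : ∀ k, A ^ k = 2 ^ (L * k) := fun k => by rw [hA, pow_mul]
  have hm3 : (J.m + 1) * (J.m + 1) * (J.m + 1) ≤ A ^ 3 := by
    calc _ ≤ A * A * A := Nat.mul_le_mul (Nat.mul_le_mul hmA hmA) hmA
      _ = A ^ 3 := by ring
  have hcodes : (J.m + 2) ^ s ≤ (L + 2) ^ s := Nat.pow_le_pow_left (by omega) s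
  constructor
  · exact hpos
  · calc roundBound s L ≤ (2 ^ (L + 1)) ^ (s + 5) := Nat.pow_le_pow_left hL2 _
      _ = 2 ^ ((L + 1) * (s + 5)) := (pow_mul _ _ _).symm
      _ < _ := hfit _ (Nat.mul_lt_mul_of_pos_left (by omega) (Nat.succ_pos L))
  · rw [hs]
    exact hcodes.trans (Nat.pow_le_pow_right (by omega) (by omega))
  · rw [hs]
    calc s ≤ 2 ^ s := Nat.lt_two_pow_self.le
      _ ≤ (L + 2) ^ s := Nat.pow_le_pow_left (by omega) s
      _ ≤ _ := Nat.pow_le_pow_right (by omega) (by omega)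
  · calc (J.m + 1) * J.width = (J.m + 1) ^ 5 := by unfold Data.width Data.base; ring
      _ ≤ (L + 2) ^ 5 := Nat.pow_le_pow_left (by omega) 5
      _ ≤ _ := Nat.pow_le_pow_right (by omega) (by omega)
  · exact hD.trans_lt (hfit' L (by omega))
  · exact hpowm.trans_lt (hfit' L (by omega))
  · refine (hsum _ _ hq).trans_lt ?_
    rw [← pow_two, hApow]
    exact hfit' _ (by omega)
  · refine (hsum _ _ hprice).trans_lt ?_
    rw [← pow_succ', hApow]
    exact hfit' _ (by omega)
  · refine (Nat.mul_le_mul hW hD).trans_lt ?_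
    rw [← pow_two, hApow]
    exact hfit' _ (by omega)
  · rw [hs]
    calc (J.m + 2) ^ s * 2 ^ J.m ≤ (2 ^ (L + 1)) ^ s * A :=
          Nat.mul_le_mul (hcodes.trans (Nat.pow_le_pow_left hL2 s)) hpowm
      _ = 2 ^ ((L + 1) * s + L) := by rw [pow_add 2 ((L + 1) * s), pow_mul]
      _ < _ := hfit _ (by rw [mul_add]; omega)
  · intro j _
    have h1 : J.q j * (J.m * J.m) / (J.n + 1) ≤ A ^ 3 := by
      calc _ ≤ J.q j * (J.m * J.m) := Nat.div_le_self _ _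
        _ ≤ A * (A * A) :=
          Nat.mul_le_mul (hq j) (Nat.mul_le_mul (by omega) (by omega))
        _ = A ^ 3 := by ring
    have h2 : 1 ≤ A ^ 3 := Nat.one_le_pow _ _ hA1
    have h3 : J.key j ≤ A ^ 3 * 4 := by
      unfold Data.key Data.rounded Data.base
      omega
    refine h3.trans_lt ?_
    rw [hApow, show (4 : ℕ) = 2 ^ 2 by norm_num, ← pow_add]
    exact hfit' _ (by omega)
  · have hv : ∀ j, J.value j * (if j < J.m then 1 else 0) ≤ A ^ 4 * 2 := fun j => by
      split_ifs with hj
      · have h1 : J.price j * 2 ^ J.m ≤ A ^ 4 := by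
          rw [pow_succ]
          exact Nat.mul_le_mul (hprice j) hpowm
        have h2 : 2 ^ j ≤ A ^ 4 := by
          calc 2 ^ j ≤ A := Nat.pow_le_pow_right (by norm_num) (by omega)
            _ ≤ A ^ 4 := Nat.le_self_pow (by norm_num) A
        unfold Data.value
        omega
      · simp
    have h1 : ∑ j ∈ range J.m, J.value j ≤ A * (A ^ 4 * 2) :=
      (sum_congr rfl fun j hj => by rw [if_pos (mem_range.1 hj), mul_one]).le.trans (hsum _ _ hv)
    have h2 : 1 ≤ A ^ 5 := Nat.one_le_pow _ _ hA1
    have h3 : A * (A ^ 4 * 2) = A ^ 5 * 2 := by ring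
    have h4 : ∑ j ∈ range J.m, J.value j + 1 ≤ A ^ 5 * 4 := by omega
    refine h4.trans_lt ?_
    rw [hApow, show (4 : ℕ) = 2 ^ 2 by norm_num, ← pow_add]
    exact hfit' _ (by omega)

theorem fits_input (a b s : ℕ) :
    Fits (bitBound a b s (bitLength I.encode)) (input (a :: b :: I.encode)) := by
  set L := bitLength I.encode with hL
  have hle : ∀ e ≤ (L + 1) * 7 + (a + b), 2 ^ e ≤ 2 ^ bitBound a b s L := fun e he =>
    Nat.pow_le_pow_right (by norm_num)
      (he.trans (Nat.add_le_add_right (Nat.mul_le_mul_left _ (by omega)) _))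
  have hself : ∀ e ≤ (L + 1) * 7 + (a + b), e < 2 ^ bitBound a b s L := fun e he =>
    Nat.lt_two_pow_self.trans_le (hle e he)
  intro x i
  unfold input
  split_ifs
  · rw [List.getD_eq_getElem?_getD]
    cases h : ((a :: b :: I.encode).length :: a :: b :: I.encode)[i]? with
    | none => simp
    | some v =>
      have hv := List.mem_of_getElem? h
      simp only [List.mem_cons] at hv
      rw [Option.getD_some]
      rcases hv with rfl | rfl | rfl | hv
      · have := length_le_bitLength I.encode
        refine hself _ ?_
        simp only [List.length_cons]
        omega
      · exact hself _ (by omega)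
      · exact hself _ (by omega)
      · refine (le_two_pow_bitLength hv).trans_lt ?_
        exact (Nat.pow_lt_pow_right (by norm_num) (Nat.lt_succ_self _)).trans_le
          (hle (L + 1) (by omega))
  · positivity

/-! ### Sets of tasks and allocations -/

theorem price_cast (a b : ℕ) (j : Fin I.m) :
    ((I.toData a b).price j : NNRat) = I.q j * I.c j * (I.toData a b).commonDen := by
  have hdvd : (I.c j).den ∣ (I.toData a b).commonDen := by
    rw [← I.toData_d a b j]
    exact dvd_prod_of_mem _ (mem_range.2 j.2)
  have hden : ((I.c j).den : NNRat) ≠ 0 := Nat.cast_ne_zero.2 (I.c j).den_ne_zero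
  rw [Data.price, toData_q, toData_c, toData_d, Nat.cast_mul, Nat.cast_mul,
    Nat.cast_div hdvd hden]
  conv_rhs => rw [← NNRat.num_div_den (I.c j)]
  field_simp

theorem commonDen_pos (a b : ℕ) : 0 < (I.toData a b).commonDen := by
  refine prod_pos fun j hj => ?_
  rw [I.toData_d a b ⟨j, mem_range.1 hj⟩]
  exact NNRat.den_pos _

theorem totalCost_eq (A : I.toProblem.Allocation) :
    I.toProblem.totalCost A = ∑ j : Fin I.m, (#(I.toProblem.robotsOf A j) : NNRat) * I.c j := by
  refine sum_congr rfl fun j _ => ?_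
  change ∑ i ∈ I.toProblem.robotsOf A j, I.c j = _
  rw [sum_const, nsmul_eq_mul]

/-- The tasks that are handled by an allocation within the budget satisfy the two knapsack
constraints. -/
theorem handled_feasible (a b : ℕ) (A : I.toProblem.Allocation)
    (hA : I.toProblem.WithinTotalBudget A) :
    ∃ S ⊆ range I.m, #S = #(I.toProblem.handled A) ∧ ∑ j ∈ S, (I.toData a b).q j ≤ I.n ∧
      ∑ j ∈ S, (I.toData a b).price j ≤ (I.toData a b).budget := by
  have hcard : ∀ j : Fin I.m, j ∈ I.toProblem.handled A → I.q j ≤ #(I.toProblem.robotsOf A j) :=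
    fun _ hj => I.toProblem.mem_handled.1 hj
  refine ⟨(I.toProblem.handled A).map Fin.valEmbedding, ?_, card_map _, ?_, ?_⟩
  · intro j hj
    obtain ⟨k, -, rfl⟩ := mem_map.1 hj
    exact mem_range.2 k.2
  · rw [sum_map]
    calc ∑ j ∈ I.toProblem.handled A, (I.toData a b).q (Fin.valEmbedding j)
        ≤ ∑ j ∈ I.toProblem.handled A, #(I.toProblem.robotsOf A j) :=
          sum_le_sum fun j hj => (I.toData_q a b j).le.trans (hcard j hj)
      _ ≤ ∑ j : Fin I.m, #(I.toProblem.robotsOf A j) := sum_le_sum_of_subset (subset_univ _)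
      _ ≤ I.n := I.toProblem.sum_card_robotsOf_le A
  · rw [sum_map, ← Nat.cast_le (α := NNRat), Nat.cast_sum, Data.budget, Nat.cast_mul]
    calc ∑ j ∈ I.toProblem.handled A, ((I.toData a b).price (Fin.valEmbedding j) : NNRat)
        ≤ ∑ j ∈ I.toProblem.handled A,
            (#(I.toProblem.robotsOf A j) : NNRat) * I.c j * (I.toData a b).commonDen :=
          sum_le_sum fun j hj => by
            refine (I.price_cast a b j).le.trans ?_
            gcongr
            exact hcard j hj
      _ ≤ ∑ j : Fin I.m,
            (#(I.toProblem.robotsOf A j) : NNRat) * I.c j * (I.toData a b).commonDen :=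
          sum_le_sum_of_subset (subset_univ _)
      _ = I.toProblem.totalCost A * (I.toData a b).commonDen := by
          rw [totalCost_eq, sum_mul]
      _ ≤ I.W * (I.toData a b).commonDen := by
          gcongr
          exact hA

/-- A set of tasks that satisfies the knapsack constraints is handled by giving consecutive
intervals of robots to its tasks. -/
theorem exists_allocation (a b x : ℕ) (hx : (I.toData a b).Feasible x) :
    ∃ A : I.toProblem.Allocation,
      I.Describes ((List.range I.m).map ((I.toData a b).start x) ++
        (List.range I.m).map ((I.toData a b).share x)) A ∧
      I.toProblem.WithinTotalBudget A ∧ (I.toData a b).count x ≤ #(I.toProblem.handled A) := by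
  classical
  set J := I.toData a b with hJ
  have hmono : ∀ {j k : ℕ}, j ≤ k → J.start x j ≤ J.start x k := fun h =>
    sum_le_sum_of_subset (range_mono h)
  have huniq : ∀ {i j k : ℕ}, J.start x j ≤ i → i < J.start x j + J.share x j →
      J.start x k ≤ i → i < J.start x k + J.share x k → j ≤ k := fun {i j k} h1 h2 h3 h4 => by
    by_contra h
    have := hmono (not_le.1 h)
    rw [Nat.succ_eq_add_one, J.start_succ] at this
    omega
  let A : I.toProblem.Allocation := fun i =>
    if h : ∃ j : Fin I.m, J.start x j ≤ (i : ℕ) ∧ (i : ℕ) < J.start x j + J.share x j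
    then some h.choose else none
  have hA : ∀ (i : Fin I.n) (j : Fin I.m), A i = some j ↔
      J.start x j ≤ (i : ℕ) ∧ (i : ℕ) < J.start x j + J.share x j := fun i j => by
    change (dite _ _ _ = _) ↔ _
    split_ifs with h
    · have hc := h.choose_spec
      refine ⟨fun h' => Option.some.inj h' ▸ hc, fun hj => congrArg some ?_⟩
      exact Fin.ext (le_antisymm (huniq hc.1 hc.2 hj.1 hj.2) (huniq hj.1 hj.2 hc.1 hc.2))
    · exact ⟨fun h' => by simp at h', fun hj => absurd ⟨j, hj⟩ h⟩
  have hcard : ∀ j : Fin I.m, #(I.toProblem.robotsOf A j) = J.share x j := fun j => by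
    have hend : J.start x j + J.share x j ≤ I.n := by
      rw [← J.start_succ]
      exact (hmono (k := I.m) j.2).trans hx.1
    have : (I.toProblem.robotsOf A j).map Fin.valEmbedding =
        Finset.Ico (J.start x j) (J.start x j + J.share x j) := by
      ext i
      rw [mem_map, mem_Ico]
      constructor
      · rintro ⟨k, hk, rfl⟩
        exact (hA k j).1 (I.toProblem.mem_robotsOf.1 hk)
      · intro hi
        exact ⟨⟨i, hi.2.trans_le hend⟩,
          I.toProblem.mem_robotsOf.2 ((hA ⟨i, hi.2.trans_le hend⟩ j).2 hi), rfl⟩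
    rw [← card_map Fin.valEmbedding, this, Nat.card_Ico]
    omega
  refine ⟨A, ⟨fun j => J.start x j, fun j => J.share x j, ?_, hA⟩, ?_, ?_⟩
  · rw [List.ofFn_eq_map, List.ofFn_eq_map, ← List.map_coe_finRange_eq_range, List.map_map,
      List.map_map]
    rfl
  · have hD : (0 : NNRat) < J.commonDen := Nat.cast_pos.2 (I.commonDen_pos a b)
    have h1 : (J.cost x : NNRat) ≤ (J.budget : ℕ) := Nat.cast_le.2 hx.2
    refine le_of_mul_le_mul_right ?_ hD
    rw [totalCost_eq, sum_mul]
    refine le_trans (le_of_eq ?_) (h1.trans (by rw [Data.budget, Nat.cast_mul]; exact le_rfl))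
    change _ = ((∑ j ∈ range I.m, bit x j * J.price j : ℕ) : NNRat)
    rw [← Fin.sum_univ_eq_sum_range (fun j => bit x j * J.price j) I.m, Nat.cast_sum]
    refine sum_congr rfl fun j _ => ?_
    rw [hcard, Data.share, Nat.cast_mul, Nat.cast_mul, hJ, price_cast, toData_q]
    ring
  · change ∑ j ∈ range I.m, bit x j ≤ _
    rw [← Fin.sum_univ_eq_sum_range (fun j => bit x j) I.m, Problem.handled,
      card_filter]
    refine sum_le_sum fun j _ => ?_
    split_ifs with h
    · exact bit_le_one x j
    · by_contra hb
      have h1 : bit x j = 1 := le_antisymm (bit_le_one x j) (by omega)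
      refine h ?_
      change I.q j ≤ _
      rw [hcard, Data.share, h1, one_mul, hJ, toData_q]

end SymProblem

end TaskAllocation

theorem mainTheorem6 :
    ∃ algorithm : RAM.Prog, ∀ ε : ℚ, 0 < ε → ∃ p : Polynomial ℕ,
      ∀ I : TaskAllocation.SymProblem,
        ∃ (out : List ℕ) (A : I.toProblem.Allocation),
          RAM.OutputsWithin algorithm (ε.num.toNat :: ε.den :: I.encode) out
            (p.eval (TaskAllocation.bitLength I.encode)) ∧
          I.Describes out A ∧
          I.toProblem.WithinTotalBudget A ∧
          (I.toProblem.opt : ℚ) ≤ (1 + ε) * ((I.toProblem.handled A).card : ℚ) := by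
  refine ⟨RAM.scheme, fun ε hε => ?_⟩
  obtain ⟨P, hP⟩ := RAM.scheme.exists_polynomial_cost
  obtain ⟨a, ha⟩ : ∃ a, ε.num.toNat = a := ⟨_, rfl⟩
  obtain ⟨b, hb⟩ : ∃ b, ε.den = b := ⟨_, rfl⟩
  rw [ha, hb]
  -- The two bounds below are polynomials in the length because `b / a + 1` depends only on `ε`.
  refine ⟨P.comp ((Polynomial.X + 2) ^ (b / a + 1 + 5)) *
    ((Polynomial.X + 1) * Polynomial.C (b / a + 1 + 7) + Polynomial.C (a + b) + 1), fun I => ?_⟩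
  obtain ⟨t, τ, hexec, ht, -, x, hx, hbest, hout⟩ :=
    TaskAllocation.Data.scheme_spec (I.bounds a b) (I.isInput a b)
      (fun y hy k => by simp [RAM.input, hy]) (I.fits_input a b _)
  obtain ⟨A, hdesc, hbudget, hcount⟩ := I.exists_allocation a b x hx
  refine ⟨_, A, ⟨t, τ, hexec, ht.trans (le_of_eq ?_), rfl⟩, hout ▸ hdesc, hbudget, ?_⟩
  · rw [← hP]
    simp [TaskAllocation.SymProblem.roundBound, TaskAllocation.SymProblem.bitBound,
      TaskAllocation.Data.small]
  · unfold TaskAllocation.Problem.opt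
    refine Finset.sup_induction (p := fun k : ℕ => (k : ℚ) ≤ (1 + ε) * _) ?_ ?_ ?_
    · simp only [bot_eq_zero', Nat.cast_zero]
      positivity
    · intro k hk l hl
      rcases le_total k l with h | h
      · rwa [sup_eq_right.2 h]
      · rwa [sup_eq_left.2 h]
    · intro A' hA'
      obtain ⟨S, hS, hcard, hq, hp⟩ := I.handled_feasible a b A' (Finset.mem_filter.1 hA').2
      obtain ⟨h1, h2⟩ := hbest S hS hq hp
      rw [← hcard]
      have hc : ((I.toData a b).count x : ℚ) ≤ ((I.toProblem.handled A).card : ℚ) :=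
        Nat.cast_le.2 hcount
      have hc0 : (0 : ℚ) ≤ ((I.toData a b).count x : ℚ) := Nat.cast_nonneg _
      refine le_trans ?_ (mul_le_mul_of_nonneg_left hc (by positivity))
      by_cases hsmall : S.card ≤ (I.toData a b).small
      · have h : (S.card : ℚ) ≤ ((I.toData a b).count x : ℚ) := Nat.cast_le.2 (h1 hsmall)
        nlinarith
      · -- More than `1 / ε` tasks are handled, so that one missing task does not matter.
        have hnum : 0 < ε.num := Rat.num_pos.2 hε
        have ha0 : 0 < a := by omega
        have hlarge : b ≤ a * (I.toData a b).count x := by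
          have h3 : b < a * (b / a + 1) := Nat.lt_mul_div_succ b ha0
          have h4 : b / a + 1 ≤ (I.toData a b).count x := by
            change ¬ S.card ≤ b / a + 1 at hsmall
            omega
          exact h3.le.trans (Nat.mul_le_mul_left a h4)
        have hb0 : (0 : ℚ) < b := by
          rw [← hb]
          exact_mod_cast ε.den_pos
        have heq : ε * b = a := by
          have h5 : ((a : ℤ) : ℚ) = ε.num := by
            rw [← ha, Int.toNat_of_nonneg hnum.le]
          rw [← hb, Rat.mul_den_eq_num, ← h5]
          rfl
        have hlarge' : (b : ℚ) ≤ a * ((I.toData a b).count x : ℚ) := by exact_mod_cast hlarge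
        have h6 : (1 : ℚ) ≤ ε * ((I.toData a b).count x : ℚ) := by
          rw [← heq] at hlarge'
          by_contra hcon
          nlinarith [mul_lt_mul_of_pos_right (not_le.1 hcon) hb0]
        have h7 : (S.card : ℚ) ≤ ((I.toData a b).count x : ℚ) + 1 := by exact_mod_cast h2
        linarith
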